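/- Let $\beta>1$. For $h\in\mathbb R$ let $\phi_{\beta,h}(m)=-\frac{m^2}{2}-hm-\frac1\beta\mathcal S(m)$ with $\mathcal S(m)=-\frac{1-m}{2}\log\frac{1-m}{2}-\frac{1+m}{2}\log\frac{1+m}{2}$ be the mean field free energy on $(-1,1)$, and let $h_c>0$ be the supremum of the $h$ for which $\phi_{\beta,h}$ has two distinct local minima. For $|h|<h_c$ let $m_-(h)<m_+(h)$ be the two local minimizers of $\phi_{\beta,h}$ in $(-1,1)$, and let $m_-(-h_c)$ be the only local minimizer of $\phi_{\beta,-h_c}$. For $N\in\mathbb N$ put $h_N(t)=-h_c\cos(N^{-2/3}t)$ and, for $m$ in $\mathcal M_N=\frac1N\{-N,-N+2,\dots,N\}$, $$\mathcal L_hf(m)=c^+(m,h)\big[f(m+\tfrac2N)-f(m)\big]+c^-(m,h)\big[f(m-\tfrac2N)-f(m)\big],$$ $$c^\pm(m,h)=\frac N2(1\mp m)\,\frac{e^{\pm\beta[h+(m\pm1/N)]}}{e^{-\beta[h+(m\pm1/N)]}+e^{\beta[h+(m\pm1/N)]}}.$$ For $\eta\in[-\frac\pi2,\frac\pi2)$ and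 $m_N\in\mathcal M_N$ let $\mathcal P_N^\eta$ be the law of the càdlàg Markov jump process $m_N(t)$, $t\in N^{2/3}[\eta,\frac\pi2]$, on $\mathcal M_N$ with time dependent generator $\mathcal L_{h_N(t)}$ and $m_N(\eta N^{2/3})=m_N$ (equivalently, the law of the càdlàg solution of the martingale problem for this generator), and let $\mathcal P_N=\mathcal P_N^{-\pi/2}$. For $I\subseteq\mathbb R$ let $$\mathcal H^\pm_\gamma(I)=\Big\{\sup_{t\in I}|m_N(t)-m_\pm(h_N(t))|\le N^{-1/2+\gamma}\Big\}.$$ Then the following hold. (1) Let $0<\eta<\frac\pi2$ and $\gamma'>\gamma>0$. For every sequence of starting points $m_N\in\mathcal M_N$ with $|m_N-m_+(0)|\le N^{-1/2+\gamma}$ for all large $N$, $$\lim_{N\to\infty}\mathcal P_N\big\{\mathcal H^+_{\gamma'}\big(N^{2/3}[-\tfrac\pi2,-\eta]\big)\big\}=1.$$ (2) Let $0<\eta<\frac\pi2$ and $\gamma'>\gamma>0$. For every sequence $m_N\in\mathcal M_N$ with $|m_N-m_+(h_N(\eta N^{2/3}))|\le N^{-1/2+\gamma}$ for all large $N$, $$\lim_{N\to\infty}\mathcal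 P_N^\eta\big\{\mathcal H^+_{\gamma'}\big(N^{2/3}[\eta,\tfrac\pi2]\big)\big\}=1.$$ (3) Let $-\frac\pi2\le\eta<\frac\pi2$ and $\gamma'>\gamma>0$. For every sequence $m_N\in\mathcal M_N$ with $|m_N-m_-(h_N(\eta N^{2/3}))|\le N^{-1/2+\gamma}$ for all large $N$, $$\lim_{N\to\infty}\mathcal P_N^\eta\big\{\mathcal H^-_{\gamma'}\big(N^{2/3}[\eta,\tfrac\pi2]\big)\big\}=1.$$ -/

import Mathlib

universe u

open Set Filter Topology MeasureTheory

namespace MeanFieldIsing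

noncomputable section

/-! ### Equilibrium: free energy, critical field and the two branches -/

/-- The entropy density `S(m)`. -/
def entropy (m : ℝ) : ℝ :=
  -((1 - m) / 2) * Real.log ((1 - m) / 2) - ((1 + m) / 2) * Real.log ((1 + m) / 2)

/-- The mean field free energy density `φ_{β,h}(m)`. -/
def freeEnergy (β h m : ℝ) : ℝ :=
  -(m ^ 2 / 2) - h * m - entropy m / β

/-- The local minimizers of `φ_{β,h}` in `(-1,1)`. -/
def localMinimizers (β h : ℝ) : Set ℝ :=
  {m | m ∈ Ioo (-1 : ℝ) 1 ∧ IsLocalMin (freeEnergy β h) m}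

/-- The critical field `h_c`: the largest field strength below which `φ_{β,h}` is a double well,
that is, has two distinct local minima. -/
def criticalField (β : ℝ) : ℝ :=
  sSup {h : ℝ | (localMinimizers β h).Nontrivial}

/-- The upper branch `m_+(h)`, for `|h| < h_c`: the larger of the two local minimizers. -/
def mPlus (β h : ℝ) : ℝ := sSup (localMinimizers β h)

/-- The lower branch `m_-(h)`, for `|h| < h_c`: the smaller of the two local minimizers.
At `h = -h_c` only this local minimizer is left. -/
def mMinus (β h : ℝ) : ℝ := sInf (localMinimizers β h)

/-! ### The magnetization process -/

/-- The state space `{-N, -N+2, ..., N} / N`. -/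
def states (N : ℕ) : Set ℝ :=
  {m | ∃ k : ℕ, k ≤ N ∧ m = (2 * (k : ℝ) - N) / N}

/-- The intensity `c^+(m,h)` of a jump `m → m + 2/N`. -/
def ratePlus (β : ℝ) (N : ℕ) (h m : ℝ) : ℝ :=
  (N : ℝ) / 2 * (1 - m) *
    (Real.exp (β * (h + (m + 1 / N))) /
      (Real.exp (-(β * (h + (m + 1 / N)))) + Real.exp (β * (h + (m + 1 / N)))))

/-- The intensity `c^-(m,h)` of a jump `m → m - 2/N`. -/
def rateMinus (β : ℝ) (N : ℕ) (h m : ℝ) : ℝ :=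
  (N : ℝ) / 2 * (1 + m) *
    (Real.exp (-(β * (h + (m - 1 / N)))) /
      (Real.exp (-(β * (h + (m - 1 / N)))) + Real.exp (β * (h + (m - 1 / N)))))

/-- The generator of the magnetization at the field `h`. -/
def generator (β : ℝ) (N : ℕ) (h : ℝ) (f : ℝ → ℝ) (m : ℝ) : ℝ :=
  ratePlus β N h m * (f (m + 2 / N) - f m) + rateMinus β N h m * (f (m - 2 / N) - f m)

/-- `X` is, under `P`, the Markov jump process on the time interval `[a,b]` with the time dependent
generator `generator β N (h t)`, started from `m₀` at time `a`: a càdlàg process in `states N` that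
solves the martingale problem for this generator. -/
structure IsMagnetizationProcess {Ω : Type*} [mΩ : MeasurableSpace Ω] (P : Measure Ω)
    (β : ℝ) (N : ℕ) (h : ℝ → ℝ) (a b m₀ : ℝ) (X : ℝ → Ω → ℝ) : Prop where
  mem_states : ∀ t ∈ Icc a b, ∀ ω, X t ω ∈ states N
  right_continuous : ∀ ω, ∀ t ∈ Icc a b, ContinuousWithinAt (fun u => X u ω) (Icc t b) t
  left_limits : ∀ ω, ∀ t ∈ Icc a b, ∃ l, Tendsto (fun u => X u ω) (𝓝[Ico a t] t) (𝓝 l)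
  initial : ∀ᵐ ω ∂P, X a ω = m₀
  martingale_problem : ∃ ℱ : Filtration (Icc a b) mΩ,
    (∀ t : Icc a b, Measurable[ℱ t] (X t)) ∧
    ∀ f : ℝ → ℝ, Martingale
      (fun (t : Icc a b) (ω : Ω) =>
        f (X t ω) - ∫ u in a..(t : ℝ), generator β N (h u) f (X u ω)) ℱ P

/-! ### The slowly oscillating field and the events -/

/-- `h_N(t) = -h_c cos (N^{-2/3} t)`. -/
def field (β : ℝ) (N : ℕ) (t : ℝ) : ℝ :=
  -criticalField β * Real.cos ((N : ℝ) ^ (-(2 / 3) : ℝ) * t)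

/-- The microscopic time `N^{2/3} τ`. -/
def scaledTime (N : ℕ) (τ : ℝ) : ℝ := (N : ℝ) ^ (2 / 3 : ℝ) * τ

/-- The tolerance `N^{-1/2+γ}`. -/
def tol (N : ℕ) (γ : ℝ) : ℝ := (N : ℝ) ^ (-(1 / 2) + γ : ℝ)

/-- The event that, for all times `t` in `I`, the path `X` is within `N^{-1/2+γ}` of the
branch `M` at the field `h_N(t)`. -/
def nearBranch {Ω : Type*} (β : ℝ) (N : ℕ) (M : ℝ → ℝ) (γ : ℝ) (I : Set ℝ)
    (X : ℝ → Ω → ℝ) : Set Ω :=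
  {ω | ∀ t ∈ I, |X t ω - M (field β N t)| ≤ tol N γ}

/-- Let the processes `m_N` run on `N^{2/3}[τ₀, π/2]` in the field `h_N`, started from points that
are, for all large `N`, within `N^{-1/2+γ}` of `M (h_N (N^{2/3} τ₀))`. Then the probability that
`m_N` stays within `N^{-1/2+γ'}` of the branch `M` on `N^{2/3}[τ₀, τ₁]` tends to one. The processes
may live on any probability spaces. -/
def TracksBranch (β : ℝ) (M : ℝ → ℝ) (τ₀ τ₁ γ γ' : ℝ) : Prop :=
  ∀ (Ω : ℕ → Type u) (_ : ∀ N, MeasurableSpace (Ω N)) (P : ∀ N, Measure (Ω N))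
    (_ : ∀ N, IsProbabilityMeasure (P N)) (m₀ : ℕ → ℝ) (X : ∀ N, ℝ → Ω N → ℝ),
    (∀ N, IsMagnetizationProcess (P N) β N (field β N)
      (scaledTime N τ₀) (scaledTime N (Real.pi / 2)) (m₀ N) (X N)) →
    (∀ᶠ N in atTop, |m₀ N - M (field β N (scaledTime N τ₀))| ≤ tol N γ) →
    Tendsto
      (fun N => P N (nearBranch β N M γ' (Icc (scaledTime N τ₀) (scaledTime N τ₁)) (X N)))
      atTop (𝓝 1)

end

end MeanFieldIsing

open MeanFieldIsing

namespace MeanFieldIsing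

noncomputable section

/-! ### State space and rates -/

/-! The magnetization drifts with velocity `tanh (β (h + m)) - m`, up to an error of order `1/N`. On
the relevant field range each branch `M` is a zero of this drift that attracts at a uniform rate
`κ`, because `β (1 - M ^ 2)` stays below a constant less than 1. The range avoids the end of the
branch: the field is at most `0 < h_c` for the lower branch, and at least `-h_c cos η > -h_c` for
the upper one. The upper branch is the mirror image of the lower one (`mPlus_eq`,
`isStableBranch_neg`).

Take the Lyapunov function `G t x = exp (√N (x - M (h t))) + exp (-√N (x - M (h t)))`. As long as
`x` is within `δ` of the branch, `(∂ₜ + L) G` is bounded by a constant independent of `N`: jumps of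
size `2/N` at total rate at most `N` contribute `O(1)` at the scale `√N`, the motion of the branch
contributes `√N · O(N^{-2/3})`, and the attraction absorbs both once `√N |x - M|` is large
(`IsStableBranch.generator_exp_add_le`).

Away from the branch nothing is known. Instead of stopping the process, `G` is composed with a
concave `C¹` function that is constant above `K = exp (N ^ γ')`; the generator bound then holds on
the whole state space. A maximal inequality (`measure_exists_le`) bounds the exit probability by `4
(exp (N ^ γ) + const · N ^ (2/3)) / exp (N ^ γ')`, which tends to 0 (`measure_deviation_le`).

The martingale problem is given only for functions of the state. Since the state space is finite,
expanding in indicators of points yields the supermartingale inequality for time-dependent functions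
(`setIntegral_le`). -/

/-- The state space as a finite set. -/
def stateFinset (N : ℕ) : Finset ℝ :=
  (Finset.range (N + 1)).image fun k : ℕ => (2 * (k : ℝ) - N) / N

lemma mem_stateFinset {N : ℕ} {m : ℝ} : m ∈ stateFinset N ↔ m ∈ states N := by
  simp only [stateFinset, states, Finset.mem_image, Finset.mem_range, Set.mem_ofPred_eq,
    Nat.lt_succ_iff, eq_comm]

lemma mem_Icc_of_mem_states {N : ℕ} {m : ℝ} (hm : m ∈ states N) : m ∈ Icc (-1 : ℝ) 1 := by
  obtain ⟨k, hk, rfl⟩ := hm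
  rcases Nat.eq_zero_or_pos N with rfl | hN
  · simp
  have hN' : (0 : ℝ) < N := by exact_mod_cast hN
  have hk' : (k : ℝ) ≤ N := by exact_mod_cast hk
  have hk0 : (0 : ℝ) ≤ k := k.cast_nonneg
  constructor
  · rw [le_div_iff₀ hN']; linarith
  · rw [div_le_iff₀ hN']; linarith

lemma ratePlus_eq (β : ℝ) (N : ℕ) (h m : ℝ) :
    ratePlus β N h m = (N : ℝ) / 2 * (1 - m) * ((1 + Real.tanh (β * (h + (m + 1 / N)))) / 2) := by
  unfold ratePlus
  rw [Real.tanh_eq]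
  have h1 := Real.exp_pos (β * (h + (m + 1 / N)))
  have h2 := Real.exp_pos (-(β * (h + (m + 1 / N))))
  congr 1
  field_simp
  ring

lemma rateMinus_eq (β : ℝ) (N : ℕ) (h m : ℝ) :
    rateMinus β N h m = (N : ℝ) / 2 * (1 + m) * ((1 - Real.tanh (β * (h + (m - 1 / N)))) / 2) := by
  unfold rateMinus
  rw [Real.tanh_eq]
  have h1 := Real.exp_pos (β * (h + (m - 1 / N)))
  have h2 := Real.exp_pos (-(β * (h + (m - 1 / N))))
  congr 1
  field_simp
  ring

lemma ratePlus_nonneg {β h m : ℝ} {N : ℕ} (hm : m ∈ Icc (-1 : ℝ) 1) : 0 ≤ ratePlus β N h m := by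
  rw [ratePlus_eq]
  have := Real.neg_one_lt_tanh (β * (h + (m + 1 / N)))
  have := hm.2
  exact mul_nonneg (mul_nonneg (by positivity) (by linarith)) (by linarith)

lemma rateMinus_nonneg {β h m : ℝ} {N : ℕ} (hm : m ∈ Icc (-1 : ℝ) 1) : 0 ≤ rateMinus β N h m := by
  rw [rateMinus_eq]
  have := Real.tanh_lt_one (β * (h + (m - 1 / N)))
  have := hm.1
  exact mul_nonneg (mul_nonneg (by positivity) (by linarith)) (by linarith)

lemma ratePlus_add_rateMinus_le {β h m : ℝ} {N : ℕ} (hm : m ∈ Icc (-1 : ℝ) 1) :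
    ratePlus β N h m + rateMinus β N h m ≤ N := by
  rw [ratePlus_eq, rateMinus_eq]
  have h1 := Real.tanh_lt_one (β * (h + (m + 1 / N)))
  have h2 := Real.neg_one_lt_tanh (β * (h + (m - 1 / N)))
  have h3 : (N : ℝ) / 2 * (1 - m) * ((1 + Real.tanh (β * (h + (m + 1 / N)))) / 2)
      ≤ (N : ℝ) / 2 * (1 - m) * 1 :=
    mul_le_mul_of_nonneg_left (by linarith)
      (mul_nonneg (by positivity) (by linarith [hm.2]))
  have h4 : (N : ℝ) / 2 * (1 + m) * ((1 - Real.tanh (β * (h + (m - 1 / N)))) / 2)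
      ≤ (N : ℝ) / 2 * (1 + m) * 1 :=
    mul_le_mul_of_nonneg_left (by linarith)
      (mul_nonneg (by positivity) (by linarith [hm.1]))
  linarith

lemma continuous_tanh : Continuous Real.tanh := by
  have : Real.tanh = fun x => Real.sinh x / Real.cosh x := by
    funext x; exact Real.tanh_eq_sinh_div_cosh x
  rw [this]
  exact Real.continuous_sinh.div Real.continuous_cosh fun x => (Real.cosh_pos x).ne'

lemma continuous_ratePlus (β : ℝ) (N : ℕ) :
    Continuous fun p : ℝ × ℝ => ratePlus β N p.1 p.2 := by
  simp only [ratePlus_eq]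
  have := continuous_tanh
  fun_prop

lemma continuous_rateMinus (β : ℝ) (N : ℕ) :
    Continuous fun p : ℝ × ℝ => rateMinus β N p.1 p.2 := by
  simp only [rateMinus_eq]
  have := continuous_tanh
  fun_prop

lemma measurable_generator (β : ℝ) (N : ℕ) {f : ℝ → ℝ} (hf : Measurable f) :
    Measurable fun p : ℝ × ℝ => generator β N p.1 f p.2 := by
  have h1 := (continuous_ratePlus β N).measurable
  have h2 := (continuous_rateMinus β N).measurable
  unfold generator
  fun_prop

lemma continuous_generator (β : ℝ) (N : ℕ) (f : ℝ → ℝ) (m : ℝ) :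
    Continuous fun h : ℝ => generator β N h f m := by
  have h1 : Continuous fun h : ℝ => ratePlus β N h m :=
    (continuous_ratePlus β N).comp (by fun_prop : Continuous fun h : ℝ => (h, m))
  have h2 : Continuous fun h : ℝ => rateMinus β N h m :=
    (continuous_rateMinus β N).comp (by fun_prop : Continuous fun h : ℝ => (h, m))
  unfold generator
  fun_prop

lemma abs_generator_le {β h m B : ℝ} {N : ℕ} {f : ℝ → ℝ} (hm : m ∈ Icc (-1 : ℝ) 1)
    (hf : ∀ x, |f x| ≤ B) : |generator β N h f m| ≤ N * (2 * B) := by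
  have hp := ratePlus_nonneg (β := β) (h := h) (N := N) hm
  have hq := rateMinus_nonneg (β := β) (h := h) (N := N) hm
  have hs := ratePlus_add_rateMinus_le (β := β) (h := h) (N := N) hm
  have hd : ∀ x y, |f x - f y| ≤ 2 * B := fun x y => by
    have := abs_sub (f x) (f y); linarith [hf x, hf y]
  have hB : 0 ≤ 2 * B := (abs_nonneg _).trans (hd 0 0)
  unfold generator
  calc _ ≤ |ratePlus β N h m * (f (m + 2 / N) - f m)| + |rateMinus β N h m * (f (m - 2 / N) - f m)| :=
        abs_add_le _ _
    _ = ratePlus β N h m * |f (m + 2 / N) - f m| + rateMinus β N h m * |f (m - 2 / N) - f m| := by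
        rw [abs_mul, abs_mul, abs_of_nonneg hp, abs_of_nonneg hq]
    _ ≤ ratePlus β N h m * (2 * B) + rateMinus β N h m * (2 * B) := by
        gcongr <;> apply hd
    _ ≤ N * (2 * B) := by rw [← add_mul]; gcongr

/-- The generator only sees the values of `f` on the state space: the process cannot leave it. -/
lemma generator_congr {β h m : ℝ} {N : ℕ} {f g : ℝ → ℝ} (hm : m ∈ states N)
    (hfg : ∀ x ∈ states N, f x = g x) : generator β N h f m = generator β N h g m := by
  obtain ⟨k, hk, rfl⟩ := hm
  rcases Nat.eq_zero_or_pos N with rfl | hN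
  · simp [generator, ratePlus, rateMinus]
  have hN' : (N : ℝ) ≠ 0 := by positivity
  unfold generator
  rw [hfg _ ⟨k, hk, rfl⟩]
  congr 1
  · rcases hk.eq_or_lt with rfl | hk'
    · have : (2 * (k : ℝ) - k) / k = 1 := by field_simp; ring
      simp [ratePlus, this]
    · rw [hfg _ ⟨k + 1, hk', by push_cast; field_simp; ring⟩]
  · rcases Nat.eq_zero_or_pos k with rfl | hk'
    · have : (2 * ((0 : ℕ) : ℝ) - N) / N = -1 := by field_simp; simp
      rw [this]
      simp [rateMinus]
    · obtain ⟨j, rfl⟩ : ∃ j, k = j + 1 := ⟨k - 1, by omega⟩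
      rw [hfg _ ⟨j, by omega, by push_cast; field_simp; ring⟩]

/-! ### Right-continuous paths -/

/-- The points `(⌊(n + 1) u⌋ + 1) / (n + 1)` converge to `u` strictly from the right, and evaluating
`Y` there factors through an integer, so `Y` is a pointwise limit of measurable functions. -/
lemma measurable_of_rightContinuous {Y : ℝ → ℝ}
    (hY : ∀ u, ContinuousWithinAt Y (Ioi u) u) : Measurable Y := by
  have hlim : ∀ u : ℝ, Tendsto (fun n : ℕ => ((⌊((n : ℝ) + 1) * u⌋ : ℝ) + 1) / (n + 1)) atTop
      (𝓝[>] u) := by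
    intro u
    have hpos : ∀ n : ℕ, (0 : ℝ) < (n : ℝ) + 1 := fun n => by positivity
    refine tendsto_nhdsWithin_iff.2 ⟨?_, Eventually.of_forall fun n => ?_⟩
    · refine tendsto_of_tendsto_of_tendsto_of_le_of_le (g := fun _ => u)
        (h := fun n : ℕ => u + 1 / ((n : ℝ) + 1)) tendsto_const_nhds ?_ ?_ ?_
      · simpa using tendsto_const_nhds.add (tendsto_one_div_add_atTop_nhds_zero_nat (𝕜 := ℝ))
      · intro n
        have := Int.lt_floor_add_one (((n : ℝ) + 1) * u)
        show u ≤ _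
        rw [le_div_iff₀ (hpos n)]; linarith
      · intro n
        have := Int.floor_le (((n : ℝ) + 1) * u)
        show _ ≤ u + _
        have h1 : (u + 1 / ((n : ℝ) + 1)) * (n + 1) = (n + 1) * u + 1 := by
          have := (hpos n).ne'
          field_simp
        rw [div_le_iff₀ (hpos n), h1]; linarith
    · have := Int.lt_floor_add_one (((n : ℝ) + 1) * u)
      show u < _
      rw [lt_div_iff₀ (hpos n)]; linarith
  refine measurable_of_tendsto_metrizable
    (f := fun (n : ℕ) u => Y (((⌊((n : ℝ) + 1) * u⌋ : ℝ) + 1) / (n + 1))) (fun n => ?_) ?_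
  · have h1 : Measurable fun k : ℤ => Y (((k : ℝ) + 1) / (n + 1)) := measurable_from_top
    exact h1.comp (Int.measurable_floor.comp (measurable_const.mul measurable_id))
  · rw [tendsto_pi_nhds]
    exact fun u => (hY u).tendsto.comp (hlim u)

/-- Paths are controlled only on `[a, b]`. Freezing time outside that interval makes them
right-continuous on the whole line. -/
lemma measurable_clamp_of_rightContinuous {a b : ℝ} {x : ℝ → ℝ}
    (hx : ∀ t ∈ Icc a b, ContinuousWithinAt x (Icc t b) t) :
    Measurable fun u => x (max a (min b u)) := by
  refine measurable_of_rightContinuous fun u => ?_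
  rcases lt_or_ge u a with hua | hau
  · have : (fun u => x (max a (min b u))) =ᶠ[𝓝 u] fun _ => x a := by
      filter_upwards [Iio_mem_nhds hua] with v hv
      have hv : v < a := hv
      rw [max_eq_left ((min_le_right _ _).trans hv.le)]
    exact (continuousAt_const.congr this.symm).continuousWithinAt
  rcases lt_or_ge u b with hub | hbu
  · have h1 : ContinuousWithinAt x (Ioi u) u :=
      (hx u ⟨hau, hub.le⟩).mono_of_mem_nhdsWithin
        (mem_of_superset (Ioo_mem_nhdsGT hub) fun v hv => ⟨hv.1.le, hv.2.le⟩)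
    refine h1.congr_of_eventuallyEq ?_ (by rw [min_eq_right hub.le, max_eq_right hau])
    filter_upwards [Ioo_mem_nhdsGT hub] with v hv
    rw [min_eq_right hv.2.le, max_eq_right (hau.trans hv.1.le)]
  · refine (continuousWithinAt_const (b := x (max a b))).congr (fun v hv => ?_) ?_
    · have hv : u < v := hv
      rw [min_eq_left (hbu.trans hv.le)]
    · rw [min_eq_left hbu]

namespace IsMagnetizationProcess

variable {Ω : Type*} [mΩ : MeasurableSpace Ω] {P : Measure Ω} {β : ℝ} {N : ℕ} {h : ℝ → ℝ}
  {a b m₀ : ℝ} {X : ℝ → Ω → ℝ}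

/-- A right-continuous path in a finite, hence discrete, set is locally constant to the right. -/
lemma eventually_eq (hX : IsMagnetizationProcess P β N h a b m₀ X) (ω : Ω) {t : ℝ}
    (ht : t ∈ Ico a b) : ∀ᶠ u in 𝓝[≥] t, X u ω = X t ω := by
  have htI : t ∈ Icc a b := ⟨ht.1, ht.2.le⟩
  have hc : Tendsto (fun u => X u ω) (𝓝[Icc t b] t) (𝓝 (X t ω)) :=
    hX.right_continuous ω t htI
  have hfin : ((stateFinset N : Set ℝ) \ {X t ω}).Finite :=
    (stateFinset N).finite_toSet.subset sdiff_subset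
  have hU : ((stateFinset N : Set ℝ) \ {X t ω})ᶜ ∈ 𝓝 (X t ω) :=
    hfin.isClosed.isOpen_compl.mem_nhds (by simp)
  have hle : 𝓝[Icc t b] t = 𝓝[≥] t := nhdsWithin_Icc_eq_nhdsGE ht.2
  rw [← hle]
  filter_upwards [hc hU, self_mem_nhdsWithin] with u hu huI
  by_contra hne
  exact hu ⟨mem_stateFinset.2 (hX.mem_states u ⟨ht.1.trans huI.1, huI.2⟩ ω), hne⟩

lemma intervalIntegrable_generator (hX : IsMagnetizationProcess P β N h a b m₀ X)
    (hh : Continuous h) {f : ℝ → ℝ} (hf : Measurable f) {B : ℝ} (hB : ∀ x, |f x| ≤ B) (ω : Ω)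
    {s t : ℝ} (hs : s ∈ Icc a b) (ht : t ∈ Icc a b) :
    IntervalIntegrable (fun u => generator β N (h u) f (X u ω)) volume s t := by
  have hsub : uIoc s t ⊆ Icc a b := uIoc_subset_uIcc.trans (uIcc_subset_Icc hs ht)
  rw [intervalIntegrable_iff]
  have hm : Measurable fun u => generator β N (h u) f (X (max a (min b u)) ω) :=
    (measurable_generator β N hf).comp
      (hh.measurable.prodMk (measurable_clamp_of_rightContinuous (hX.right_continuous ω)))
  have hi : IntegrableOn (fun u => generator β N (h u) f (X (max a (min b u)) ω)) (uIoc s t) := by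
    refine Measure.integrableOn_of_bounded (M := N * (2 * B)) (by simp [uIoc])
      hm.aestronglyMeasurable ?_
    refine (ae_restrict_iff' measurableSet_uIoc).2 (Eventually.of_forall fun u hu => ?_)
    have := hsub hu
    rw [min_eq_right this.2, max_eq_right this.1]
    exact abs_generator_le (mem_Icc_of_mem_states (hX.mem_states u this ω)) hB
  refine hi.congr_fun (fun u hu => ?_) measurableSet_uIoc
  have := hsub hu
  simp only [min_eq_right this.2, max_eq_right this.1]

lemma abs_integral_generator_le (hX : IsMagnetizationProcess P β N h a b m₀ X)
    {f : ℝ → ℝ} {B : ℝ} (hB : ∀ x, |f x| ≤ B) (ω : Ω)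
    {s t : ℝ} (hs : s ∈ Icc a b) (ht : t ∈ Icc a b) :
    |∫ u in s..t, generator β N (h u) f (X u ω)| ≤ N * (2 * B) * |t - s| :=
  intervalIntegral.norm_integral_le_of_norm_le_const (E := ℝ) fun u hu =>
    abs_generator_le (mem_Icc_of_mem_states
      (hX.mem_states u (uIoc_subset_uIcc.trans (uIcc_subset_Icc hs ht) hu) ω)) hB

lemma hasDerivWithinAt_integral_generator (hX : IsMagnetizationProcess P β N h a b m₀ X)
    (hh : Continuous h) (f : ℝ → ℝ) (ω : Ω) {t : ℝ} (ht : t ∈ Ico a b) :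
    HasDerivWithinAt (fun v => ∫ u in t..v, generator β N (h u) f (X u ω))
      (generator β N (h t) f (X t ω)) (Ici t) t := by
  have hev := hX.eventually_eq ω ht
  have hcont : HasDerivWithinAt (fun v => ∫ u in t..v, generator β N (h u) f (X t ω))
      (generator β N (h t) f (X t ω)) (Ici t) t := by
    have hc : Continuous fun u => generator β N (h u) f (X t ω) :=
      (continuous_generator β N f (X t ω)).comp hh
    exact (hc.integral_hasStrictDerivAt t t).hasDerivAt.hasDerivWithinAt
  refine hcont.congr_of_eventuallyEq ?_ (by simp)
  obtain ⟨c, hc, hcs⟩ := mem_nhdsGE_iff_exists_Ico_subset.1 hev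
  filter_upwards [Ico_mem_nhdsGE hc] with v hv
  refine intervalIntegral.integral_congr fun u hu => ?_
  rw [uIcc_of_le hv.1] at hu
  have : X u ω = X t ω := hcs ⟨hu.1, hu.2.trans_lt hv.2⟩
  simp only [this]

end IsMagnetizationProcess

/-! ### Dynkin's formula on a finite state space -/

lemma generator_finset_sum (β : ℝ) (N : ℕ) (h m : ℝ) (S : Finset ℝ) (c : ℝ → ℝ)
    (f : ℝ → ℝ → ℝ) :
    generator β N h (fun x => ∑ y ∈ S, c y * f y x) m
      = ∑ y ∈ S, c y * generator β N h (f y) m := by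
  simp only [generator, ← Finset.sum_sub_distrib, Finset.mul_sum, ← Finset.sum_add_distrib]
  exact Finset.sum_congr rfl fun y _ => by ring

lemma sum_mul_indicator_singleton (N : ℕ) (g : ℝ → ℝ) {x : ℝ} (hx : x ∈ states N) :
    ∑ y ∈ stateFinset N, g y * ({y} : Set ℝ).indicator (1 : ℝ → ℝ) x = g x := by
  rw [Finset.sum_eq_single x]
  · simp
  · intro y _ hy
    simp [hy.symm]
  · exact fun h => absurd (mem_stateFinset.2 hx) h

lemma abs_indicator_singleton_le (y x : ℝ) :
    |({y} : Set ℝ).indicator (1 : ℝ → ℝ) x| ≤ 1 := by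
  by_cases h : x = y <;> simp [h]

namespace IsMagnetizationProcess

variable {Ω : Type*} [mΩ : MeasurableSpace Ω] {P : Measure Ω} [IsProbabilityMeasure P]
  {β : ℝ} {N : ℕ} {h : ℝ → ℝ} {a b m₀ : ℝ} {X : ℝ → Ω → ℝ} {ℱ : Filtration (Icc a b) mΩ}

lemma integrable_comp (hℱ : ∀ t : Icc a b, Measurable[ℱ t] (X t)) {f : ℝ → ℝ}
    (hf : Measurable f) {B : ℝ} (hB : ∀ x, |f x| ≤ B) {t : ℝ} (ht : t ∈ Icc a b) :
    Integrable (fun ω => f (X t ω)) P := by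
  have hXm : Measurable (X t) := (hℱ ⟨t, ht⟩).mono (ℱ.le _) le_rfl
  exact Integrable.of_bound (hf.comp hXm).aestronglyMeasurable B
    (Eventually.of_forall fun ω => hB _)

lemma integrable_integral_generator (hX : IsMagnetizationProcess P β N h a b m₀ X)
    (hh : Continuous h) (hℱ : ∀ t : Icc a b, Measurable[ℱ t] (X t))
    (hM : ∀ f : ℝ → ℝ, Martingale (fun (t : Icc a b) (ω : Ω) =>
      f (X t ω) - ∫ u in a..(t : ℝ), generator β N (h u) f (X u ω)) ℱ P)
    {f : ℝ → ℝ} (hf : Measurable f) {B : ℝ} (hB : ∀ x, |f x| ≤ B) {s t : ℝ}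
    (hs : s ∈ Icc a b) (ht : t ∈ Icc a b) :
    Integrable (fun ω => ∫ u in s..t, generator β N (h u) f (X u ω)) P := by
  have ha : a ∈ Icc a b := ⟨le_rfl, hs.1.trans hs.2⟩
  have key : ∀ v ∈ Icc a b,
      Integrable (fun ω => ∫ u in a..v, generator β N (h u) f (X u ω)) P := fun v hv => by
    refine ((integrable_comp hℱ hf hB hv).sub ((hM f).integrable ⟨v, hv⟩)).congr
      (Eventually.of_forall fun ω => ?_)
    simp
  refine ((key t ht).sub (key s hs)).congr (Eventually.of_forall fun ω => ?_)
  exact intervalIntegral.integral_interval_sub_left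
    (hX.intervalIntegrable_generator hh hf hB ω ha ht)
    (hX.intervalIntegrable_generator hh hf hB ω ha hs)

lemma setIntegral_sub_eq (hX : IsMagnetizationProcess P β N h a b m₀ X)
    (hh : Continuous h) (hℱ : ∀ t : Icc a b, Measurable[ℱ t] (X t))
    (hM : ∀ f : ℝ → ℝ, Martingale (fun (t : Icc a b) (ω : Ω) =>
      f (X t ω) - ∫ u in a..(t : ℝ), generator β N (h u) f (X u ω)) ℱ P)
    {f : ℝ → ℝ} (hf : Measurable f) {B : ℝ} (hB : ∀ x, |f x| ≤ B) {s t : ℝ}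
    (hs : s ∈ Icc a b) (ht : t ∈ Icc a b) (hst : s ≤ t) {A : Set Ω}
    (hA : MeasurableSet[ℱ ⟨s, hs⟩] A) :
    ∫ ω in A, f (X t ω) ∂P - ∫ ω in A, f (X s ω) ∂P
      = ∫ ω in A, (∫ u in s..t, generator β N (h u) f (X u ω)) ∂P := by
  have ha : a ∈ Icc a b := ⟨le_rfl, hs.1.trans hs.2⟩
  have hE := (hM f).setIntegral_eq (i := ⟨s, hs⟩) (j := ⟨t, ht⟩) hst hA
  simp only at hE
  rw [integral_sub (integrable_comp hℱ hf hB hs).integrableOn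
      (hX.integrable_integral_generator hh hℱ hM hf hB ha hs).integrableOn,
    integral_sub (integrable_comp hℱ hf hB ht).integrableOn
      (hX.integrable_integral_generator hh hℱ hM hf hB ha ht).integrableOn] at hE
  have h2 : ∫ ω in A, (∫ u in s..t, generator β N (h u) f (X u ω)) ∂P
      = ∫ ω in A, (∫ u in a..t, generator β N (h u) f (X u ω)) ∂P
        - ∫ ω in A, (∫ u in a..s, generator β N (h u) f (X u ω)) ∂P := by
    rw [← integral_sub (hX.integrable_integral_generator hh hℱ hM hf hB ha ht).integrableOn
      (hX.integrable_integral_generator hh hℱ hM hf hB ha hs).integrableOn]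
    refine integral_congr_ae (Eventually.of_forall fun ω => ?_)
    exact (intervalIntegral.integral_interval_sub_left
      (hX.intervalIntegrable_generator hh hf hB ω ha ht)
      (hX.intervalIntegrable_generator hh hf hB ω ha hs)).symm
  rw [h2]; linarith

/-- At fixed `N` the generator of a bounded function is bounded, so these expectations are Lipschitz
in time. -/
lemma continuousOn_setIntegral (hX : IsMagnetizationProcess P β N h a b m₀ X)
    (hh : Continuous h) (hℱ : ∀ t : Icc a b, Measurable[ℱ t] (X t))
    (hM : ∀ f : ℝ → ℝ, Martingale (fun (t : Icc a b) (ω : Ω) =>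
      f (X t ω) - ∫ u in a..(t : ℝ), generator β N (h u) f (X u ω)) ℱ P)
    {f : ℝ → ℝ} (hf : Measurable f) {B : ℝ} (hB : ∀ x, |f x| ≤ B) {s : ℝ}
    (hs : s ∈ Icc a b) {A : Set Ω} (hA : MeasurableSet[ℱ ⟨s, hs⟩] A) :
    ContinuousOn (fun v => ∫ ω in A, f (X v ω) ∂P) (Icc s b) := by
  have hB0 : 0 ≤ B := (abs_nonneg _).trans (hB 0)
  have key : ∀ u ∈ Icc s b, ∀ v ∈ Icc s b, u ≤ v →
      |∫ ω in A, f (X v ω) ∂P - ∫ ω in A, f (X u ω) ∂P| ≤ N * (2 * B) * |v - u| := by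
    intro u hu v hv huv
    have hu' : u ∈ Icc a b := ⟨hs.1.trans hu.1, hu.2⟩
    have hv' : v ∈ Icc a b := ⟨hs.1.trans hv.1, hv.2⟩
    have hsu : (⟨s, hs⟩ : Icc a b) ≤ ⟨u, hu'⟩ := hu.1
    rw [hX.setIntegral_sub_eq hh hℱ hM hf hB hu' hv' huv (ℱ.mono hsu _ hA)]
    have h1 := norm_setIntegral_le_of_norm_le_const (μ := P) (s := A)
      (f := fun ω => ∫ u in u..v, generator β N (h u) f (X u ω)) (C := N * (2 * B) * |v - u|)
      (measure_lt_top _ _) fun ω _ => hX.abs_integral_generator_le hB ω hu' hv'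
    refine h1.trans ?_
    exact mul_le_of_le_one_right (by positivity) measureReal_le_one
  refine (LipschitzOnWith.of_dist_le_mul (K := ⟨N * (2 * B), by positivity⟩) ?_).continuousOn
  intro u hu v hv
  rw [Real.dist_eq, Real.dist_eq]
  rcases le_total u v with huv | huv
  · rw [abs_sub_comm, abs_sub_comm u v]; exact key u hu v hv huv
  · exact key v hv u hu huv

/-- The difference quotients of the compensator converge pathwise, by local constancy to the right,
and are bounded by `2 N B`, so dominated convergence applies. -/
lemma hasDerivWithinAt_setIntegral (hX : IsMagnetizationProcess P β N h a b m₀ X)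
    (hh : Continuous h) (hℱ : ∀ t : Icc a b, Measurable[ℱ t] (X t))
    (hM : ∀ f : ℝ → ℝ, Martingale (fun (t : Icc a b) (ω : Ω) =>
      f (X t ω) - ∫ u in a..(t : ℝ), generator β N (h u) f (X u ω)) ℱ P)
    {f : ℝ → ℝ} (hf : Measurable f) {B : ℝ} (hB : ∀ x, |f x| ≤ B) {s t : ℝ}
    (hs : s ∈ Icc a b) (hst : s ≤ t) (htb : t < b) {A : Set Ω}
    (hA : MeasurableSet[ℱ ⟨s, hs⟩] A) :
    HasDerivWithinAt (fun v => ∫ ω in A, f (X v ω) ∂P)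
      (∫ ω in A, generator β N (h t) f (X t ω) ∂P) (Ici t) t := by
  have ht : t ∈ Icc a b := ⟨hs.1.trans hst, htb.le⟩
  have hst' : (⟨s, hs⟩ : Icc a b) ≤ ⟨t, ht⟩ := hst
  have hA' := ℱ.mono hst' _ hA
  rw [hasDerivWithinAt_iff_tendsto_slope, Ici_sdiff_left]
  have hev : (fun v => ∫ ω in A, ((v - t)⁻¹ * ∫ u in t..v, generator β N (h u) f (X u ω)) ∂P)
      =ᶠ[𝓝[>] t] slope (fun v => ∫ ω in A, f (X v ω) ∂P) t := by
    filter_upwards [Ioo_mem_nhdsGT htb] with v hv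
    rw [slope_def_field, integral_const_mul,
      ← hX.setIntegral_sub_eq hh hℱ hM hf hB ht ⟨ht.1.trans hv.1.le, hv.2.le⟩ hv.1.le hA',
      div_eq_inv_mul]
  refine Tendsto.congr' hev ?_
  refine tendsto_integral_filter_of_dominated_convergence (fun _ => N * (2 * B)) ?_ ?_ ?_ ?_
  · filter_upwards [Ioo_mem_nhdsGT htb] with v hv
    exact ((hX.integrable_integral_generator hh hℱ hM hf hB ht
      ⟨ht.1.trans hv.1.le, hv.2.le⟩).integrableOn.aestronglyMeasurable).const_mul _
  · filter_upwards [Ioo_mem_nhdsGT htb] with v hv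
    refine Eventually.of_forall fun ω => ?_
    have hpos : 0 < v - t := sub_pos.2 hv.1
    have := hX.abs_integral_generator_le hB ω ht ⟨ht.1.trans hv.1.le, hv.2.le⟩
    rw [abs_of_pos hpos] at this
    rw [Real.norm_eq_abs, abs_mul, abs_of_pos (inv_pos.2 hpos), inv_mul_le_iff₀ hpos]
    linarith
  · exact integrable_const _
  · refine Eventually.of_forall fun ω => ?_
    have hd := hX.hasDerivWithinAt_integral_generator hh f ω ⟨ht.1, htb⟩
    rw [hasDerivWithinAt_iff_tendsto_slope, Ici_sdiff_left] at hd
    refine hd.congr fun v => ?_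
    simp [slope_def_field, div_eq_inv_mul]

/-- Dynkin's formula for time-dependent functions, as an inequality: if `(∂ₜ + L) F ≤ C` along
the state space then `F (t, X t) - C t` is a supermartingale. -/
lemma setIntegral_le (hX : IsMagnetizationProcess P β N h a b m₀ X)
    (hh : Continuous h) (hℱ : ∀ t : Icc a b, Measurable[ℱ t] (X t))
    (hM : ∀ f : ℝ → ℝ, Martingale (fun (t : Icc a b) (ω : Ω) =>
      f (X t ω) - ∫ u in a..(t : ℝ), generator β N (h u) f (X u ω)) ℱ P)
    {c C : ℝ} (hcb : c ≤ b) {F F' : ℝ → ℝ → ℝ}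
    (hFc : ∀ x ∈ states N, ContinuousOn (fun t => F t x) (Icc a c))
    (hFd : ∀ x ∈ states N, ∀ t ∈ Ico a c, HasDerivWithinAt (fun t => F t x) (F' t x) (Ici t) t)
    (hgen : ∀ x ∈ states N, ∀ t ∈ Ico a c, F' t x + generator β N (h t) (F t) x ≤ C)
    {s t : ℝ} (hs : s ∈ Icc a b) (hst : s ≤ t) (htc : t ≤ c) {A : Set Ω}
    (hA : MeasurableSet[ℱ ⟨s, hs⟩] A) :
    ∫ ω in A, F t (X t ω) ∂P ≤ ∫ ω in A, F s (X s ω) ∂P + C * P.real A * (t - s) := by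
  let e : ℝ → ℝ → ℝ := fun y => ({y} : Set ℝ).indicator (1 : ℝ → ℝ)
  have hem : ∀ y, Measurable (e y) := fun y =>
    measurable_one.indicator (measurableSet_singleton y)
  have heB : ∀ y x, |e y x| ≤ 1 := abs_indicator_singleton_le
  have hexp : ∀ (g : ℝ → ℝ), ∀ v ∈ Icc s c,
      ∫ ω in A, g (X v ω) ∂P = ∑ y ∈ stateFinset N, g y * ∫ ω in A, e y (X v ω) ∂P := by
    intro g v hv
    have hv' : v ∈ Icc a b := ⟨hs.1.trans hv.1, hv.2.trans hcb⟩
    simp only [← integral_const_mul]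
    rw [← integral_finsetSum _ fun y _ =>
      ((integrable_comp hℱ (hem y) (heB y) hv').const_mul (g y)).integrableOn]
    refine integral_congr_ae (Eventually.of_forall fun ω => ?_)
    exact (sum_mul_indicator_singleton N g (hX.mem_states v hv' ω)).symm
  have hAm : MeasurableSet A := ℱ.le _ _ hA
  have hgi : ∀ y, ∀ v ∈ Icc a b, Integrable (fun ω => generator β N (h v) (e y) (X v ω)) P := by
    intro y v hv
    have hXm : Measurable (X v) := (hℱ ⟨v, hv⟩).mono (ℱ.le _) le_rfl
    refine Integrable.of_bound (((measurable_generator β N (hem y)).comp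
      (measurable_const.prodMk hXm)).aestronglyMeasurable) (N * (2 * 1))
      (Eventually.of_forall fun ω => ?_)
    exact abs_generator_le (mem_Icc_of_mem_states (hX.mem_states v hv ω)) (heB y)
  -- In the indicator expansion the expectation is a finite sum of products of two functions of
  -- time. Both factors have right derivatives, so the product rule applies, and a comparison with
  -- the affine function of slope `C * P.real A` finishes.
  have main := image_le_of_deriv_right_le_deriv_boundary (a := s) (b := c)
    (f := fun v => ∑ y ∈ stateFinset N, F v y * ∫ ω in A, e y (X v ω) ∂P)
    (f' := fun v => ∑ y ∈ stateFinset N, (F' v y * ∫ ω in A, e y (X v ω) ∂P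
      + F v y * ∫ ω in A, generator β N (h v) (e y) (X v ω) ∂P))
    (B := fun v => ∑ y ∈ stateFinset N, F s y * ∫ ω in A, e y (X s ω) ∂P + C * P.real A * (v - s))
    (B' := fun _ => C * P.real A) ?_ ?_ (by simp) ?_ ?_ ?_ ⟨hst, htc⟩
  · rw [hexp (F t) t ⟨hst, htc⟩, hexp (F s) s ⟨le_rfl, hst.trans htc⟩]
    exact main
  · refine continuousOn_finsetSum _ fun y hy => ContinuousOn.mul ?_ ?_
    · exact (hFc y (mem_stateFinset.1 hy)).mono (Icc_subset_Icc_left hs.1)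
    · exact (hX.continuousOn_setIntegral hh hℱ hM (hem y) (heB y) hs hA).mono
        (Icc_subset_Icc_right hcb)
  · intro v hv
    refine HasDerivWithinAt.fun_sum fun y hy => ?_
    exact (hFd y (mem_stateFinset.1 hy) v ⟨hs.1.trans hv.1, hv.2⟩).mul
      (hX.hasDerivWithinAt_setIntegral hh hℱ hM (hem y) (heB y) hs hv.1 (hv.2.trans_le hcb) hA)
  · fun_prop
  · intro v _
    have h1 : HasDerivAt (fun v => C * P.real A * (v - s)) (C * P.real A * 1) v :=
      ((hasDerivAt_id v).sub_const s).const_mul _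
    rw [mul_one] at h1
    exact (h1.const_add _).hasDerivWithinAt
  · intro v hv
    have hv' : v ∈ Icc a b := ⟨hs.1.trans hv.1, (hv.2.trans_le hcb).le⟩
    have hpt : ∀ ω, (∑ y ∈ stateFinset N, (F' v y * e y (X v ω)
        + F v y * generator β N (h v) (e y) (X v ω))) ≤ C := by
      intro ω
      have hx := hX.mem_states v hv' ω
      rw [Finset.sum_add_distrib, sum_mul_indicator_singleton N (F' v) hx,
        ← generator_finset_sum,
        generator_congr (g := F v) hx fun x hx => sum_mul_indicator_singleton N (F v) hx]
      exact hgen _ hx v ⟨hs.1.trans hv.1, hv.2⟩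
    have hint : ∀ y ∈ stateFinset N, Integrable (fun ω => F' v y * e y (X v ω)
        + F v y * generator β N (h v) (e y) (X v ω)) (P.restrict A) := fun y _ =>
      (((integrable_comp hℱ (hem y) (heB y) hv').const_mul _).add
        ((hgi y v hv').const_mul _)).integrableOn
    calc ∑ y ∈ stateFinset N, (F' v y * ∫ ω in A, e y (X v ω) ∂P
          + F v y * ∫ ω in A, generator β N (h v) (e y) (X v ω) ∂P)
        = ∫ ω in A, ∑ y ∈ stateFinset N, (F' v y * e y (X v ω)
          + F v y * generator β N (h v) (e y) (X v ω)) ∂P := by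
          rw [integral_finsetSum _ hint]
          refine Finset.sum_congr rfl fun y _ => ?_
          rw [integral_add ((integrable_comp hℱ (hem y) (heB y) hv').const_mul _).integrableOn
            ((hgi y v hv').const_mul _).integrableOn, integral_const_mul, integral_const_mul]
      _ ≤ ∫ _ in A, C ∂P :=
          integral_mono (integrable_finsetSum _ hint) (integrable_const _) hpt
      _ = C * P.real A := by simp [mul_comm]

end IsMagnetizationProcess

/-! ### Maximal inequalities -/

/-- The maximal inequality for nonnegative supermartingales in discrete time. -/
lemma supermartingale_maximal {Ω : Type*} [mΩ : MeasurableSpace Ω] {P : Measure Ω}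
    [IsFiniteMeasure P] {𝒢 : ℕ → MeasurableSpace Ω} (hle : ∀ k, 𝒢 k ≤ mΩ) (hmono : Monotone 𝒢)
    {Z : ℕ → Ω → ℝ} (hZm : ∀ k, Measurable[𝒢 k] (Z k)) (hZi : ∀ k, Integrable (Z k) P)
    (hZ0 : ∀ k ω, 0 ≤ Z k ω)
    (hsup : ∀ k A, MeasurableSet[𝒢 k] A → ∫ ω in A, Z (k + 1) ω ∂P ≤ ∫ ω in A, Z k ω ∂P)
    (l : ℝ) (n : ℕ) :
    l * P.real {ω | ∃ k < n, l ≤ Z k ω} ≤ ∫ ω, Z 0 ω ∂P := by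
  let D : ℕ → Set Ω := fun n => {ω | ∃ k < n, l ≤ Z k ω}
  have hDm : ∀ n, MeasurableSet[𝒢 n] (D (n + 1)) := by
    intro n
    have : D (n + 1) = ⋃ k ∈ Finset.range (n + 1), {ω | l ≤ Z k ω} := by
      ext ω; simp [D]
    rw [this]
    refine Finset.measurableSet_biUnion _ fun k hk => ?_
    exact hmono (Nat.lt_succ_iff.1 (Finset.mem_range.1 hk)) _ (measurableSet_le
      (@measurable_const _ _ _ (𝒢 k) l) (hZm k))
  have hD0 : D 0 = ∅ := by ext ω; simp [D]
  have hDm' : ∀ n, MeasurableSet (D n) := by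
    rintro (_ | n)
    · rw [hD0]; exact MeasurableSet.empty
    · exact hle n _ (hDm n)
  have hDsub : ∀ n, D n ⊆ D (n + 1) := fun n ω ⟨k, hk, h⟩ => ⟨k, hk.trans n.lt_succ_self, h⟩
  -- Paths that have reached level `l` are charged `l`, the others their current value; this total
  -- never increases. As `D n` looks only at times before `n`, a first crossing at time `n` is paid
  -- for by `Z n` before the supermartingale step, which is taken on the complement of `D (n + 1)`.
  have key : ∀ n, l * P.real (D n) + ∫ ω in (D n)ᶜ, Z n ω ∂P ≤ ∫ ω, Z 0 ω ∂P := by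
    intro n
    induction n with
    | zero => simp [hD0]
    | succ n ih =>
      refine le_trans ?_ ih
      have h1 := hsup n _ (hDm n).compl
      have hunion : (D n)ᶜ = (D (n + 1) \ D n) ∪ (D (n + 1))ᶜ := by
        ext ω
        have := @hDsub n ω
        simp only [mem_compl_iff, mem_union, Set.mem_sdiff]
        tauto
      have hdisj : Disjoint (D (n + 1) \ D n) (D (n + 1))ᶜ :=
        disjoint_compl_right.mono_left sdiff_subset
      have h2 : ∫ ω in (D n)ᶜ, Z n ω ∂P
          = ∫ ω in D (n + 1) \ D n, Z n ω ∂P + ∫ ω in (D (n + 1))ᶜ, Z n ω ∂P := by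
        rw [hunion]
        exact setIntegral_union hdisj (hDm' _).compl (hZi n).integrableOn (hZi n).integrableOn
      have h3 : l * P.real (D (n + 1) \ D n) ≤ ∫ ω in D (n + 1) \ D n, Z n ω ∂P := by
        have : ∫ _ in D (n + 1) \ D n, l ∂P ≤ ∫ ω in D (n + 1) \ D n, Z n ω ∂P := by
          refine setIntegral_mono_on (integrable_const _).integrableOn (hZi n).integrableOn
            ((hDm' _).diff (hDm' _)) fun ω hω => ?_
          obtain ⟨⟨k, hk, hkl⟩, hn⟩ := hω
          rcases (Nat.lt_succ_iff.1 hk).eq_or_lt with rfl | hk'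
          · exact hkl
          · exact absurd ⟨k, hk', hkl⟩ hn
        simpa [mul_comm] using this
      have h4 : P.real (D (n + 1) \ D n) = P.real (D (n + 1)) - P.real (D n) :=
        measureReal_sdiff (hDsub n) (hDm' n)
      rw [h4] at h3
      linarith
  have h5 : 0 ≤ ∫ ω in (D n)ᶜ, Z n ω ∂P := integral_nonneg (hZ0 n)
  linarith [key n]

/-- The points `a + (c - a) k / (n + 1)` of the uniform grid in `[a, c]`. -/
def gridPoint (a c : ℝ) (n k : ℕ) : ℝ := a + (c - a) * ((min k (n + 1) : ℕ) / (n + 1 : ℝ))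

lemma gridPoint_mono {a c : ℝ} (hac : a ≤ c) (n : ℕ) : Monotone (gridPoint a c n) := by
  intro k l hkl
  have : ((min k (n + 1) : ℕ) : ℝ) ≤ ((min l (n + 1) : ℕ) : ℝ) := by
    exact_mod_cast min_le_min_right _ hkl
  have h0 : 0 ≤ c - a := sub_nonneg.2 hac
  unfold gridPoint
  gcongr

lemma gridPoint_zero (a c : ℝ) (n : ℕ) : gridPoint a c n 0 = a := by simp [gridPoint]

lemma gridPoint_last (a c : ℝ) (n : ℕ) : gridPoint a c n (n + 1) = c := by
  have : ((n : ℝ) + 1) ≠ 0 := by positivity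
  simp [gridPoint, this]

lemma gridPoint_mem {a c : ℝ} (hac : a ≤ c) (n k : ℕ) : gridPoint a c n k ∈ Icc a c := by
  constructor
  · exact (gridPoint_zero a c n).ge.trans (gridPoint_mono hac n (Nat.zero_le k))
  · have : gridPoint a c n k = gridPoint a c n (min k (n + 1)) := by simp [gridPoint]
    rw [this]
    conv_rhs => rw [← gridPoint_last a c n]
    exact gridPoint_mono hac n (min_le_right _ _)

lemma exists_gridPoint_mem_Ico {a c t ε : ℝ} {n : ℕ} (ht : t ∈ Ico a c)
    (hn : (c - a) / (n + 1) < ε) : ∃ k < n + 2, gridPoint a c n k ∈ Ico t (t + ε) := by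
  have hca : 0 < c - a := sub_pos.2 (ht.1.trans_lt ht.2)
  have hn1 : (0 : ℝ) < (n : ℝ) + 1 := by positivity
  set r : ℝ := (t - a) / (c - a) * (n + 1) with hr
  have hr0 : 0 ≤ r := mul_nonneg (div_nonneg (sub_nonneg.2 ht.1) hca.le) hn1.le
  have hr1 : r ≤ (n + 1 : ℕ) := by
    push_cast
    refine mul_le_of_le_one_left hn1.le ((div_le_one hca).2 ?_)
    linarith [ht.2]
  have hk : ⌈r⌉₊ ≤ n + 1 := Nat.ceil_le.2 hr1
  have hrt : a + (c - a) * (r / (n + 1)) = t := by rw [hr]; field_simp; ring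
  refine ⟨⌈r⌉₊, by omega, ?_⟩
  unfold gridPoint
  rw [min_eq_left hk]
  constructor
  · calc t = a + (c - a) * (r / (n + 1)) := hrt.symm
      _ ≤ _ := by gcongr; exact Nat.le_ceil r
  · calc a + (c - a) * ((⌈r⌉₊ : ℕ) / (n + 1 : ℝ))
        ≤ a + (c - a) * ((r + 1) / (n + 1)) := by gcongr; exact (Nat.ceil_lt_add_one hr0).le
      _ = t + (c - a) / (n + 1) := by rw [← hrt]; ring
      _ < t + ε := by gcongr

namespace IsMagnetizationProcess

variable {Ω : Type*} [mΩ : MeasurableSpace Ω] {P : Measure Ω} [IsProbabilityMeasure P]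
  {β : ℝ} {N : ℕ} {h : ℝ → ℝ} {a b m₀ : ℝ} {X : ℝ → Ω → ℝ}

/-- Maximal inequality: if `F ≥ 0` and `(∂ₜ + L) F ≤ C`, then the process is unlikely to ever meet
a right-open set of space-time points on which `F` is large. -/
lemma measure_exists_le (hX : IsMagnetizationProcess P β N h a b m₀ X)
    (hh : Continuous h) {c C l : ℝ} (hac : a ≤ c) (hcb : c ≤ b) (hC : 0 ≤ C) (hl : 0 < l)
    {F F' : ℝ → ℝ → ℝ} (hFm : ∀ t, Measurable (F t)) (hF0 : ∀ t x, 0 ≤ F t x)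
    (hFc : ∀ x ∈ states N, ContinuousOn (fun t => F t x) (Icc a c))
    (hFd : ∀ x ∈ states N, ∀ t ∈ Ico a c, HasDerivWithinAt (fun t => F t x) (F' t x) (Ici t) t)
    (hgen : ∀ x ∈ states N, ∀ t ∈ Ico a c, F' t x + generator β N (h t) (F t) x ≤ C)
    {bad : ℝ → ℝ → Prop} (hbad : ∀ t x, bad t x → l ≤ F t x)
    (hopen : ∀ x, ∀ t ∈ Ico a c, bad t x → ∀ᶠ u in 𝓝[≥] t, bad u x) :
    P {ω | ∃ t ∈ Icc a c, bad t (X t ω)} ≤ ENNReal.ofReal ((F a m₀ + C * (c - a)) / l) := by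
  obtain ⟨ℱ, hℱ, hM⟩ := hX.martingale_problem
  have hIcc : ∀ {t}, t ∈ Icc a c → t ∈ Icc a b := fun ht => ⟨ht.1, ht.2.trans hcb⟩
  have hFi : ∀ t ∈ Icc a c, Integrable (fun ω => F t (X t ω)) P := by
    intro t ht
    have hXm : Measurable (X t) := (hℱ ⟨t, hIcc ht⟩).mono (ℱ.le _) le_rfl
    refine Integrable.of_bound ((hFm t).comp hXm).aestronglyMeasurable
      (∑ y ∈ stateFinset N, F t y) (Eventually.of_forall fun ω => ?_)
    rw [Real.norm_eq_abs, abs_of_nonneg (hF0 _ _)]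
    exact Finset.single_le_sum (f := fun y => F t y) (fun y _ => hF0 t y)
      (mem_stateFinset.2 (hX.mem_states t (hIcc ht) ω))
  let A : ℕ → Set Ω := fun n => {ω | ∃ k < n + 2, bad (gridPoint a c n k) (X (gridPoint a c n k) ω)}
  have hA : ∀ n, P (A n) ≤ ENNReal.ofReal ((F a m₀ + C * (c - a)) / l) := by
    intro n
    have hg : ∀ k, gridPoint a c n k ∈ Icc a c := gridPoint_mem hac n
    let τ : ℕ → Icc a b := fun k => ⟨gridPoint a c n k, hIcc (hg k)⟩
    have hτ : Monotone τ := fun i j hij => gridPoint_mono hac n hij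
    -- The term `C * (c - t)` offsets growth at rate `C`, and it is nonnegative on the grid, so `Z`
    -- is a nonnegative supermartingale.
    let Z : ℕ → Ω → ℝ := fun k ω =>
      F (gridPoint a c n k) (X (gridPoint a c n k) ω) + C * (c - gridPoint a c n k)
    have hZi : ∀ k, Integrable (Z k) P := fun k => (hFi _ (hg k)).add (integrable_const _)
    have hmax := supermartingale_maximal (P := P) (𝒢 := fun k => ℱ (τ k)) (fun k => ℱ.le _)
      (fun i j hij => ℱ.mono (hτ hij)) (Z := Z)
      (fun k => ((hFm _).comp (hℱ (τ k))).add measurable_const) hZi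
      (fun k ω => add_nonneg (hF0 _ _) (mul_nonneg hC (sub_nonneg.2 (hg k).2))) ?_ l (n + 2)
    · have hinit : ∫ ω, Z 0 ω ∂P = F a m₀ + C * (c - a) := by
        have : Z 0 =ᵐ[P] fun _ => F a m₀ + C * (c - a) := by
          filter_upwards [hX.initial] with ω hω
          simp only [Z, gridPoint_zero, hω]
        rw [integral_congr_ae this]; simp
      rw [hinit] at hmax
      have hsub : A n ⊆ {ω | ∃ k < n + 2, l ≤ Z k ω} := by
        rintro ω ⟨k, hk, hb⟩
        exact ⟨k, hk, (hbad _ _ hb).trans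
          (le_add_of_nonneg_right (mul_nonneg hC (sub_nonneg.2 (hg k).2)))⟩
      refine (measure_mono hsub).trans ?_
      rw [← ofReal_measureReal]
      refine ENNReal.ofReal_le_ofReal ?_
      rw [le_div_iff₀ hl]
      linarith
    · intro k B hB
      have h1 := hX.setIntegral_le hh hℱ hM hcb hFc hFd hgen (hIcc (hg k))
        (gridPoint_mono hac n k.le_succ) (hg (k + 1)).2 hB
      simp only [Z]
      rw [integral_add (hFi _ (hg _)).integrableOn (integrable_const _),
        integral_add (hFi _ (hg _)).integrableOn (integrable_const _)]
      simp only [integral_const, measureReal_restrict_apply_univ, smul_eq_mul]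
      linarith
  -- A bad time `t < c` starts a whole interval of bad times, since the path is constant to the
  -- right and `bad` is open to the right; every sufficiently fine grid meets that interval. The
  -- time `c` belongs to every grid.
  have hsub : {ω | ∃ t ∈ Icc a c, bad t (X t ω)} ⊆ ⋃ n, ⋂ m, A (n + m) := by
    rintro ω ⟨t, ht, hb⟩
    rcases ht.2.eq_or_lt with rfl | htc
    · refine mem_iUnion.2 ⟨0, mem_iInter.2 fun m => ⟨0 + m + 1, by omega, ?_⟩⟩
      rw [gridPoint_last]; exact hb
    have htc' : t ∈ Ico a c := ⟨ht.1, htc⟩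
    have hev : ∀ᶠ u in 𝓝[≥] t, bad u (X u ω) := by
      filter_upwards [hopen _ t htc' hb, hX.eventually_eq ω ⟨ht.1, htc.trans_le hcb⟩] with u h1 h2
      rwa [h2]
    obtain ⟨e, he, hes⟩ := mem_nhdsGE_iff_exists_Ico_subset.1 hev
    have he' : 0 < e - t := sub_pos.2 he
    have hlim : Tendsto (fun n : ℕ => (c - a) / ((n : ℝ) + 1)) atTop (𝓝 0) := by
      simpa [div_eq_mul_inv] using
        (tendsto_one_div_add_atTop_nhds_zero_nat (𝕜 := ℝ)).const_mul (c - a)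
    obtain ⟨n, hn⟩ := eventually_atTop.1 (hlim.eventually_lt_const he')
    refine mem_iUnion.2 ⟨n, mem_iInter.2 fun m => ?_⟩
    obtain ⟨k, hk, hkm⟩ := exists_gridPoint_mem_Ico htc' (hn (n + m) (by omega))
    rw [add_sub_cancel] at hkm
    exact ⟨k, hk, hes hkm⟩
  refine (measure_mono hsub).trans ?_
  have hmono : Monotone fun n => ⋂ m, A (n + m) := by
    intro i j hij ω hω
    refine mem_iInter.2 fun m => ?_
    have := mem_iInter.1 hω (j - i + m)
    rwa [show i + (j - i + m) = j + m by omega] at this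
  -- Continuity along increasing unions needs no measurability, so the bad event need not be
  -- measurable.
  rw [hmono.measure_iUnion]
  exact iSup_le fun n => (measure_mono (iInter_subset _ 0)).trans (hA _)

end IsMagnetizationProcess

/-! ### Hyperbolic tangent -/

lemma hasDerivAt_tanh (x : ℝ) : HasDerivAt Real.tanh (1 - Real.tanh x ^ 2) x := by
  have hc := (Real.cosh_pos x).ne'
  have h1 := (Real.hasDerivAt_sinh x).div (Real.hasDerivAt_cosh x) hc
  have h2 : (Real.sinh / Real.cosh : ℝ → ℝ) = Real.tanh := by
    funext y; exact (Real.tanh_eq_sinh_div_cosh y).symm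
  rw [h2] at h1
  refine h1.congr_deriv ?_
  rw [Real.tanh_eq_sinh_div_cosh]
  field_simp

lemma abs_tanh_sub_tanh_le (x y : ℝ) : |Real.tanh x - Real.tanh y| ≤ |x - y| := by
  have := convex_univ.norm_image_sub_le_of_norm_hasDerivWithin_le (f := Real.tanh) (C := 1)
    (fun z _ => (hasDerivAt_tanh z).hasDerivWithinAt) (fun z _ => ?_) (mem_univ y) (mem_univ x)
  · simpa using this
  · have h1 := Real.tanh_lt_one z
    have h2 := Real.neg_one_lt_tanh z
    rw [Real.norm_eq_abs, abs_le]
    constructor <;> nlinarith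

lemma hasDerivAt_artanh {m : ℝ} (hm : m ∈ Ioo (-1 : ℝ) 1) :
    HasDerivAt Real.artanh (1 - m ^ 2)⁻¹ m := by
  have hc : ContinuousAt Real.artanh m := by
    have hev : Real.artanh =ᶠ[𝓝 m] fun x => 1 / 2 * Real.log ((1 + x) / (1 - x)) := by
      filter_upwards [Ioo_mem_nhds hm.1 hm.2] with x hx
      exact Real.artanh_eq_half_log ⟨hx.1.le, hx.2.le⟩
    refine ContinuousAt.congr ?_ hev.symm
    have h1 : 1 - m ≠ 0 := by linarith [hm.2]
    have h2 : (1 + m) / (1 - m) ≠ 0 := div_ne_zero (by linarith [hm.1]) h1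
    fun_prop (disch := assumption)
  have h1 := hasDerivAt_tanh (Real.artanh m)
  rw [Real.tanh_artanh hm] at h1
  refine h1.of_local_left_inverse hc ?_ ?_
  · nlinarith [hm.1, hm.2]
  · filter_upwards [Ioo_mem_nhds hm.1 hm.2] with x hx using Real.tanh_artanh hx

lemma artanh_neg_eq {m : ℝ} (hm : m ∈ Ioo (-1 : ℝ) 1) : Real.artanh (-m) = -Real.artanh m := by
  rw [← Real.artanh_tanh (-Real.artanh m), Real.tanh_neg, Real.tanh_artanh hm]

/-! ### The equation of state -/

/-- The field at which `m` is a critical point of the free energy. -/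
def stateField (β m : ℝ) : ℝ := Real.artanh m / β - m

/-- The positive point where `stateField` turns around. -/
def spinodal (β : ℝ) : ℝ := √(1 - 1 / β)

lemma hasDerivAt_stateField (β : ℝ) {m : ℝ} (hm : m ∈ Ioo (-1 : ℝ) 1) :
    HasDerivAt (stateField β) ((1 - m ^ 2)⁻¹ / β - 1) m :=
  ((hasDerivAt_artanh hm).div_const β).sub (hasDerivAt_id m)

lemma continuousOn_stateField (β : ℝ) : ContinuousOn (stateField β) (Ioo (-1) 1) := fun _ hm =>
  (hasDerivAt_stateField β hm).continuousAt.continuousWithinAt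

/-- The entropy has derivative `-artanh m`, so the critical points for the field `h` form the level
set of `stateField β` at `h`. -/
lemma hasDerivAt_freeEnergy (β h : ℝ) {m : ℝ} (hm : m ∈ Ioo (-1 : ℝ) 1) :
    HasDerivAt (freeEnergy β h) (stateField β m - h) m := by
  have hp : 0 < (1 - m) / 2 := by linarith [hm.2]
  have hq : 0 < (1 + m) / 2 := by linarith [hm.1]
  have dp : HasDerivAt (fun m : ℝ => (1 - m) / 2) (-1 / 2) m :=
    ((hasDerivAt_id m).const_sub 1).div_const 2
  have dq : HasDerivAt (fun m : ℝ => (1 + m) / 2) (1 / 2) m :=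
    ((hasDerivAt_id m).const_add 1).div_const 2
  have dS : HasDerivAt entropy (-Real.artanh m) m := by
    have := (dp.neg.mul (dp.log hp.ne')).sub (dq.mul (dq.log hq.ne'))
    refine this.congr_deriv ?_
    have hl : Real.artanh m = 1 / 2 * (Real.log ((1 + m) / 2) - Real.log ((1 - m) / 2)) := by
      rw [Real.artanh_eq_half_log ⟨hm.1.le, hm.2.le⟩, ← Real.log_div hq.ne' hp.ne']
      congr 2
      field_simp
    rw [hl]
    simp only [Pi.neg_apply]
    have h1 : (1 - m) ≠ 0 := by linarith
    have h2 : (1 + m) ≠ 0 := by linarith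
    field_simp
    ring
  have d1 : HasDerivAt (fun m : ℝ => -(m ^ 2 / 2)) (-m) m := by
    have := (((hasDerivAt_id m).pow 2).div_const 2).neg
    refine this.congr_deriv ?_
    simp
  have d2 : HasDerivAt (fun m : ℝ => h * m) h m := by
    simpa using (hasDerivAt_id m).const_mul h
  have := (d1.sub d2).sub (dS.div_const β)
  refine this.congr_deriv ?_
  rw [stateField]; ring

lemma stateField_eq_of_mem_localMinimizers {β h m : ℝ} (hm : m ∈ localMinimizers β h) :
    stateField β m = h := by
  have := hm.2.hasDerivAt_eq_zero (hasDerivAt_freeEnergy β h hm.1)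
  linarith

lemma spinodal_pos {β : ℝ} (hβ : 1 < β) : 0 < spinodal β :=
  Real.sqrt_pos.2 (sub_pos.2 ((div_lt_one (by linarith)).2 hβ))

lemma spinodal_sq {β : ℝ} (hβ : 1 < β) : spinodal β ^ 2 = 1 - 1 / β :=
  Real.sq_sqrt (sub_nonneg.2 ((div_le_one (by linarith)).2 hβ.le))

lemma mul_one_sub_spinodal_sq {β : ℝ} (hβ : 1 < β) : β * (1 - spinodal β ^ 2) = 1 := by
  rw [spinodal_sq hβ]; field_simp; ring

lemma spinodal_lt_one {β : ℝ} (hβ : 1 < β) : spinodal β < 1 := by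
  have h1 := mul_one_sub_spinodal_sq hβ
  have h2 := spinodal_pos hβ
  by_contra! h3
  have h4 : 1 - spinodal β ^ 2 ≤ 0 := by nlinarith
  nlinarith

/-- The derivative `1 / (β (1 - m ^ 2)) - 1` is positive exactly when `m ^ 2` exceeds `spinodal β ^
2`. -/
lemma strictMonoOn_stateField {β : ℝ} (hβ : 1 < β) : StrictMonoOn (stateField β) (Ioc (-1) (-spinodal β)) := by
  have h0 := spinodal_pos hβ
  have h1 := mul_one_sub_spinodal_sq hβ
  refine strictMonoOn_of_deriv_pos (convex_Ioc _ _)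
    ((continuousOn_stateField β).mono fun x hx => ⟨hx.1, by linarith [hx.2]⟩) fun m hm => ?_
  rw [interior_Ioc] at hm
  have hm' : m ∈ Ioo (-1 : ℝ) 1 := ⟨hm.1, by linarith [hm.2]⟩
  rw [(hasDerivAt_stateField β hm').deriv, sub_pos, lt_div_iff₀ (by linarith), one_mul,
    lt_inv_comm₀ (by linarith) (by nlinarith [hm'.1, hm'.2]), inv_eq_one_div,
    lt_div_iff₀ (by linarith)]
  have hsq : spinodal β ^ 2 < m ^ 2 := by nlinarith [hm.2]
  nlinarith

lemma strictAntiOn_stateField {β : ℝ} (hβ : 1 < β) : StrictAntiOn (stateField β) (Icc (-spinodal β) (spinodal β)) := by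
  have h0 := spinodal_pos hβ
  have hs := spinodal_lt_one hβ
  have h1 := mul_one_sub_spinodal_sq hβ
  refine strictAntiOn_of_deriv_neg (convex_Icc _ _) ((continuousOn_stateField β).mono fun x hx =>
    ⟨by linarith [hx.1], by linarith [hx.2]⟩) fun m hm => ?_
  rw [interior_Icc] at hm
  have hm' : m ∈ Ioo (-1 : ℝ) 1 := ⟨by linarith [hm.1], by linarith [hm.2]⟩
  have hsq : m ^ 2 < spinodal β ^ 2 := sq_lt_sq' hm.1 hm.2
  rw [(hasDerivAt_stateField β hm').deriv, sub_neg, div_lt_iff₀ (by linarith), one_mul,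
    inv_lt_comm₀ (by nlinarith [hm'.1, hm'.2]) (by linarith), inv_eq_one_div,
    div_lt_iff₀ (by linarith)]
  nlinarith

lemma stateField_neg_spinodal_pos {β : ℝ} (hβ : 1 < β) : 0 < stateField β (-spinodal β) := by
  have h0 := spinodal_pos hβ
  have := strictAntiOn_stateField hβ (a := -spinodal β) (b := 0) ⟨le_rfl, by linarith⟩
    ⟨by linarith, h0.le⟩ (by linarith)
  simpa [stateField] using this

lemma exists_stateField_eq {β : ℝ} (hβ : 1 < β) {h : ℝ} (hh : h < stateField β (-spinodal β)) :
    ∃ m ∈ Ioo (-1) (-spinodal β), stateField β m = h := by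
  have h0 := spinodal_pos hβ
  have hs := spinodal_lt_one hβ
  have hβ0 : 0 < β := by linarith
  have hsm : -spinodal β ∈ Ioo (-1 : ℝ) 1 := ⟨by linarith, by linarith⟩
  -- The first entry makes `stateField β (tanh y) ≤ h`, since `tanh y > -1`; the second keeps `tanh
  -- y` at or below `-spinodal β`. The intermediate value theorem then applies on `[tanh y,
  -- -spinodal β]`.
  set y := min (β * (h - 1)) (Real.artanh (-spinodal β)) with hy
  have hty : Real.tanh y ∈ Ioo (-1 : ℝ) 1 := ⟨Real.neg_one_lt_tanh y, Real.tanh_lt_one y⟩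
  have hle : Real.tanh y ≤ -spinodal β := by
    rw [← Real.artanh_le_artanh_iff hty hsm, Real.artanh_tanh]; exact min_le_right _ _
  have hval : stateField β (Real.tanh y) ≤ h := by
    rw [stateField, Real.artanh_tanh]
    have : y / β ≤ h - 1 := by rw [div_le_iff₀' hβ0]; exact min_le_left _ _
    linarith [hty.1]
  obtain ⟨m, hm, hmh⟩ := intermediate_value_Icc hle ((continuousOn_stateField β).mono
    fun x hx => ⟨hty.1.trans_le hx.1, hx.2.trans_lt hsm.2⟩) ⟨hval, hh.le⟩
  refine ⟨m, ⟨hty.1.trans_le hm.1, lt_of_le_of_ne hm.2 ?_⟩, hmh⟩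
  rintro rfl
  exact hh.ne' hmh

/-! ### Local minimizers -/

lemma mem_localMinimizers_of_lt {β : ℝ} (hβ : 1 < β) {h m : ℝ} (hm : m ∈ Ioo (-1) (-spinodal β))
    (hmh : stateField β m = h) : m ∈ localMinimizers β h := by
  have h0 := spinodal_pos hβ
  have hd : ∀ {x}, x ∈ Ioo (-1) (-spinodal β) → x ∈ Ioo (-1 : ℝ) 1 := fun hx =>
    ⟨hx.1, by linarith [hx.2]⟩
  have hmono := strictMonoOn_stateField hβ
  refine ⟨hd hm, isLocalMin_of_deriv_Ioo hm.1 hm.2 ?_ ?_ ?_ ?_ ?_⟩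
  · exact (hasDerivAt_freeEnergy β h (hd hm)).continuousAt
  · exact fun x hx => (hasDerivAt_freeEnergy β h
      (hd ⟨hx.1, hx.2.trans hm.2⟩)).differentiableAt.differentiableWithinAt
  · exact fun x hx => (hasDerivAt_freeEnergy β h
      (hd ⟨hm.1.trans hx.1, hx.2⟩)).differentiableAt.differentiableWithinAt
  · intro x hx
    rw [(hasDerivAt_freeEnergy β h (hd ⟨hx.1, hx.2.trans hm.2⟩)).deriv, ← hmh, sub_nonpos]
    exact (hmono ⟨hx.1, (hx.2.trans hm.2).le⟩ ⟨hm.1, hm.2.le⟩ hx.2).le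
  · intro x hx
    rw [(hasDerivAt_freeEnergy β h (hd ⟨hm.1.trans hx.1, hx.2⟩)).deriv, ← hmh, sub_nonneg]
    exact (hmono ⟨hm.1, hm.2.le⟩ ⟨hm.1.trans hx.1, hx.2.le⟩ hx.1).le

/-- Between the spinodal points `stateField` decreases, so the free energy falls strictly to the
right of a critical point `m < spinodal β`. At `m = spinodal β` it is strictly smaller on the left
instead. Thus both spinodal points are excluded as well. -/
lemma lt_or_lt_of_mem_localMinimizers {β : ℝ} (hβ : 1 < β) {h m : ℝ} (hm : m ∈ localMinimizers β h) :
    m < -spinodal β ∨ spinodal β < m := by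
  have h0 := spinodal_pos hβ
  have hs := spinodal_lt_one hβ
  have hmh := stateField_eq_of_mem_localMinimizers hm
  have hanti := strictAntiOn_stateField hβ
  by_contra! hcon
  obtain ⟨h1, h2⟩ := hcon
  have hd : ∀ {x}, x ∈ Icc (-spinodal β) (spinodal β) → x ∈ Ioo (-1 : ℝ) 1 := fun hx =>
    ⟨by linarith [hx.1], by linarith [hx.2]⟩
  have hcont : ∀ {D : Set ℝ}, D ⊆ Icc (-spinodal β) (spinodal β) →
      ContinuousOn (freeEnergy β h) D := fun hD x hx =>
    (hasDerivAt_freeEnergy β h (hd (hD hx))).continuousAt.continuousWithinAt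
  have hloc : ∀ᶠ x in 𝓝 m, freeEnergy β h m ≤ freeEnergy β h x := hm.2
  rcases h2.lt_or_eq with h2 | h2
  · have hsub : Icc m (spinodal β) ⊆ Icc (-spinodal β) (spinodal β) := Icc_subset_Icc_left h1
    have hlt : StrictAntiOn (freeEnergy β h) (Icc m (spinodal β)) := by
      refine strictAntiOn_of_deriv_neg (convex_Icc _ _) (hcont hsub) fun x hx => ?_
      rw [interior_Icc] at hx
      have hx' : x ∈ Icc (-spinodal β) (spinodal β) := hsub ⟨hx.1.le, hx.2.le⟩
      rw [(hasDerivAt_freeEnergy β h (hd hx')).deriv, ← hmh, sub_neg]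
      exact hanti ⟨h1, h2.le⟩ hx' hx.1
    have hev : ∀ᶠ x in 𝓝[>] m, freeEnergy β h m ≤ freeEnergy β h x ∧ x ∈ Ioo m (spinodal β) :=
      (hloc.filter_mono nhdsWithin_le_nhds).and (Ioo_mem_nhdsGT h2)
    obtain ⟨x, hx1, hx2⟩ := hev.exists
    exact absurd (hlt ⟨le_rfl, h2.le⟩ ⟨hx2.1.le, hx2.2.le⟩ hx2.1) (not_lt.2 hx1)
  · have hlt : StrictMonoOn (freeEnergy β h) (Icc (-spinodal β) (spinodal β)) := by
      refine strictMonoOn_of_deriv_pos (convex_Icc _ _) (hcont subset_rfl) fun x hx => ?_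
      rw [interior_Icc] at hx
      have hx' : x ∈ Icc (-spinodal β) (spinodal β) := ⟨hx.1.le, hx.2.le⟩
      rw [(hasDerivAt_freeEnergy β h (hd hx')).deriv, ← hmh, sub_pos]
      exact hanti hx' ⟨h1, h2.le⟩ (h2 ▸ hx.2)
    have hlt' : -spinodal β < m := by linarith
    have hev : ∀ᶠ x in 𝓝[<] m,
        freeEnergy β h m ≤ freeEnergy β h x ∧ x ∈ Ioo (-spinodal β) m :=
      (hloc.filter_mono nhdsWithin_le_nhds).and (Ioo_mem_nhdsLT hlt')
    obtain ⟨x, hx1, hx2⟩ := hev.exists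
    exact absurd (hlt ⟨hx2.1.le, by linarith [hx2.2]⟩ ⟨h1, h2.le⟩ hx2.2) (not_lt.2 hx1)

lemma freeEnergy_neg (β h m : ℝ) : freeEnergy β (-h) (-m) = freeEnergy β h m := by
  simp only [freeEnergy, entropy, sub_neg_eq_add, ← sub_eq_add_neg]; ring

lemma neg_mem_localMinimizers {β h m : ℝ} (hm : m ∈ localMinimizers β h) :
    -m ∈ localMinimizers β (-h) := by
  refine ⟨⟨by linarith [hm.1.2], by linarith [hm.1.1]⟩, ?_⟩
  have h1 : ∀ᶠ x in 𝓝 m, freeEnergy β h m ≤ freeEnergy β h x := hm.2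
  have ht : Tendsto (fun x : ℝ => -x) (𝓝 (-m)) (𝓝 m) := by
    simpa using (continuous_neg.tendsto (-m))
  filter_upwards [ht.eventually h1] with x hx
  rw [freeEnergy_neg, ← neg_neg x, freeEnergy_neg]
  exact hx

lemma mPlus_eq (β h : ℝ) : mPlus β h = -mMinus β (-h) := by
  rw [mPlus, mMinus, ← Real.sSup_neg]
  congr 1
  ext m
  rw [Set.mem_neg]
  refine ⟨neg_mem_localMinimizers, fun hm => ?_⟩
  simpa using neg_mem_localMinimizers hm

lemma eq_of_mem_localMinimizers {β : ℝ} (hβ : 1 < β) {h m m' : ℝ} (hm : m ∈ localMinimizers β h)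
    (hm' : m' ∈ localMinimizers β h) (h1 : m < -spinodal β) (h2 : m' < -spinodal β) : m = m' :=
  (strictMonoOn_stateField hβ).injOn ⟨hm.1.1, h1.le⟩ ⟨hm'.1.1, h2.le⟩ <| by
    rw [stateField_eq_of_mem_localMinimizers hm, stateField_eq_of_mem_localMinimizers hm']

lemma lt_of_mem_localMinimizers {β : ℝ} (hβ : 1 < β) {h m : ℝ} (hm : m ∈ localMinimizers β h)
    (h1 : m < -spinodal β) : h < stateField β (-spinodal β) := by
  rw [← stateField_eq_of_mem_localMinimizers hm]
  exact strictMonoOn_stateField hβ ⟨hm.1.1, h1.le⟩ ⟨by linarith [spinodal_lt_one hβ], le_rfl⟩ h1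

/-- Each outer region contains at most one minimizer, so two distinct ones lie on opposite sides,
and each side imposes one of the two bounds on `h`. -/
lemma nontrivial_localMinimizers_iff {β : ℝ} (hβ : 1 < β) {h : ℝ} : (localMinimizers β h).Nontrivial ↔
    h ∈ Ioo (-stateField β (-spinodal β)) (stateField β (-spinodal β)) := by
  have h0 := spinodal_pos hβ
  constructor
  · rintro ⟨x, hx, y, hy, hxy⟩
    have hx' := neg_mem_localMinimizers hx
    have hy' := neg_mem_localMinimizers hy
    rcases lt_or_lt_of_mem_localMinimizers hβ hx with h1 | h1 <;>
      rcases lt_or_lt_of_mem_localMinimizers hβ hy with h2 | h2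
    · exact absurd (eq_of_mem_localMinimizers hβ hx hy h1 h2) hxy
    · have := lt_of_mem_localMinimizers hβ hy' (neg_lt_neg h2)
      exact ⟨by linarith, lt_of_mem_localMinimizers hβ hx h1⟩
    · have := lt_of_mem_localMinimizers hβ hx' (neg_lt_neg h1)
      exact ⟨by linarith, lt_of_mem_localMinimizers hβ hy h2⟩
    · exact absurd (neg_inj.1 (eq_of_mem_localMinimizers hβ hx' hy' (neg_lt_neg h1)
        (neg_lt_neg h2))) hxy
  · rintro ⟨h1, h2⟩
    obtain ⟨x, hx, hxh⟩ := exists_stateField_eq hβ h2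
    obtain ⟨y, hy, hyh⟩ := exists_stateField_eq hβ (h := -h) (by linarith)
    have := neg_mem_localMinimizers (mem_localMinimizers_of_lt hβ hy hyh)
    rw [neg_neg] at this
    exact ⟨x, mem_localMinimizers_of_lt hβ hx hxh, -y, this, by
      intro hxy; linarith [hx.2, hy.2]⟩

lemma criticalField_eq {β : ℝ} (hβ : 1 < β) : criticalField β = stateField β (-spinodal β) := by
  have h0 := stateField_neg_spinodal_pos hβ
  have : {h : ℝ | (localMinimizers β h).Nontrivial}
      = Ioo (-stateField β (-spinodal β)) (stateField β (-spinodal β)) := by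
    ext h; exact nontrivial_localMinimizers_iff hβ
  rw [criticalField, this, csSup_Ioo (by linarith)]

lemma criticalField_pos {β : ℝ} (hβ : 1 < β) : 0 < criticalField β := by
  rw [criticalField_eq hβ]; exact stateField_neg_spinodal_pos hβ

/-- This covers every field below `h_c`, not only the bistable range; in particular `h = -h_c`,
which the slow field reaches at time 0. -/
lemma mMinus_spec {β : ℝ} (hβ : 1 < β) {h : ℝ} (hh : h < criticalField β) :
    mMinus β h ∈ Ioo (-1) (-spinodal β) ∧ stateField β (mMinus β h) = h := by
  rw [criticalField_eq hβ] at hh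
  obtain ⟨m, hm, hmh⟩ := exists_stateField_eq hβ hh
  have hmin := mem_localMinimizers_of_lt hβ hm hmh
  have hleast : IsLeast (localMinimizers β h) m := by
    refine ⟨hmin, fun x hx => ?_⟩
    rcases lt_or_lt_of_mem_localMinimizers hβ hx with h1 | h1
    · exact (eq_of_mem_localMinimizers hβ hmin hx hm.2 h1).le
    · linarith [hm.2, spinodal_pos hβ]
  rw [mMinus, hleast.csInf_eq]
  exact ⟨hm, hmh⟩

lemma mMinus_lt_of_lt_stateField {β : ℝ} (hβ : 1 < β) {h m : ℝ} (hh : h < criticalField β)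
    (hm : m ∈ Ioc (-1) (-spinodal β)) (hhm : h < stateField β m) : mMinus β h < m := by
  obtain ⟨h1, h2⟩ := mMinus_spec hβ hh
  rw [← h2] at hhm
  exact ((strictMonoOn_stateField hβ).lt_iff_lt ⟨h1.1, h1.2.le⟩ hm).1 hhm

lemma lt_mMinus_of_stateField_lt {β : ℝ} (hβ : 1 < β) {h m : ℝ} (hh : h < criticalField β)
    (hm : m ∈ Ioc (-1) (-spinodal β)) (hhm : stateField β m < h) : m < mMinus β h := by
  obtain ⟨h1, h2⟩ := mMinus_spec hβ hh
  rw [← h2] at hhm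
  exact ((strictMonoOn_stateField hβ).lt_iff_lt hm ⟨h1.1, h1.2.le⟩).1 hhm

lemma continuousAt_mMinus {β : ℝ} (hβ : 1 < β) {h : ℝ} (hh : h < criticalField β) : ContinuousAt (mMinus β) h := by
  obtain ⟨⟨h1, h2⟩, h3⟩ := mMinus_spec hβ hh
  have hmono := strictMonoOn_stateField hβ
  refine tendsto_order.2 ⟨fun x hx => ?_, fun x hx => ?_⟩
  · obtain ⟨y, hy1, hy2⟩ := exists_between (max_lt h1 hx)
    have hyI : y ∈ Ioc (-1) (-spinodal β) :=
      ⟨(le_max_left _ _).trans_lt hy1, (hy2.trans h2).le⟩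
    have hlt : stateField β y < h := by
      rw [← h3]; exact hmono hyI ⟨h1, h2.le⟩ hy2
    filter_upwards [Ioo_mem_nhds hlt hh] with k hk
    exact ((le_max_right _ _).trans_lt hy1).trans (lt_mMinus_of_stateField_lt hβ hk.2 hyI hk.1)
  · obtain ⟨y, hy1, hy2⟩ := exists_between (lt_min h2 hx)
    have hyI : y ∈ Ioc (-1) (-spinodal β) :=
      ⟨h1.trans hy1, (hy2.trans_le (min_le_left _ _)).le⟩
    have hlt : h < stateField β y := by
      rw [← h3]; exact hmono ⟨h1, h2.le⟩ hyI hy1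
    filter_upwards [Iio_mem_nhds hlt, Iio_mem_nhds hh] with k hk hk'
    exact (mMinus_lt_of_lt_stateField hβ hk' hyI hk).trans (hy2.trans_le (min_le_right _ _))

lemma mMinus_mono {β : ℝ} (hβ : 1 < β) {h h' : ℝ} (hh' : h' < criticalField β) (hle : h ≤ h') :
    mMinus β h ≤ mMinus β h' := by
  rcases hle.eq_or_lt with rfl | hlt
  · exact le_rfl
  obtain ⟨h1, h2⟩ := mMinus_spec hβ hh'
  exact (mMinus_lt_of_lt_stateField hβ (hlt.trans hh') ⟨h1.1, h1.2.le⟩ (by rwa [h2])).le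

lemma one_sub_pos_of_mem {β : ℝ} (hβ : 1 < β) {m : ℝ} (hm : m ∈ Ioo (-1) (-spinodal β)) :
    0 < 1 - β * (1 - m ^ 2) := by
  have h0 := spinodal_pos hβ
  have h1 := mul_one_sub_spinodal_sq hβ
  have hsq : spinodal β ^ 2 < m ^ 2 := by nlinarith [hm.2]
  nlinarith

/-- The branch is a continuous local inverse of `stateField β`, whose derivative does not vanish
beyond the spinodal point. -/
lemma hasDerivAt_mMinus {β : ℝ} (hβ : 1 < β) {h : ℝ} (hh : h < criticalField β) :
    HasDerivAt (mMinus β)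
      (β * (1 - mMinus β h ^ 2) / (1 - β * (1 - mMinus β h ^ 2))) h := by
  obtain ⟨hm, h3⟩ := mMinus_spec hβ hh
  have h0 := spinodal_pos hβ
  have hpos := one_sub_pos_of_mem hβ hm
  have hm' : mMinus β h ∈ Ioo (-1 : ℝ) 1 := ⟨hm.1, by linarith [hm.2]⟩
  have hq : 0 < 1 - mMinus β h ^ 2 := by nlinarith [hm'.1, hm'.2]
  have hval : (1 - mMinus β h ^ 2)⁻¹ / β - 1
      = (1 - β * (1 - mMinus β h ^ 2)) / (β * (1 - mMinus β h ^ 2)) := by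
    field_simp
  have hd := hasDerivAt_stateField β hm'
  rw [hval] at hd
  have := hd.of_local_left_inverse (continuousAt_mMinus hβ hh)
    (div_pos hpos (mul_pos (by linarith) hq)).ne' (by
      filter_upwards [Iio_mem_nhds hh] with k hk using (mMinus_spec hβ hk).2)
  rwa [inv_div] at this

/-! ### Stable branches of the mean field dynamics -/

/-- `M` is, for fields in `J`, a uniformly stable branch of equilibria of the mean field dynamics
`m' = tanh (β (h + m)) - m`, and depends smoothly on the field. -/
structure IsStableBranch (β : ℝ) (M : ℝ → ℝ) (J : Set ℝ) (κ δ D : ℝ) : Prop where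
  deriv_bound : ∀ h ∈ J, ∃ d, |d| ≤ D ∧ HasDerivAt M d h
  equilibrium : ∀ h ∈ J, Real.tanh (β * (h + M h)) = M h
  drift_le : ∀ h ∈ J, ∀ x, M h ≤ x → x ≤ M h + δ →
    Real.tanh (β * (h + x)) - x ≤ -(κ * (x - M h))
  le_drift : ∀ h ∈ J, ∀ x, M h - δ ≤ x → x ≤ M h →
    κ * (M h - x) ≤ Real.tanh (β * (h + x)) - x

lemma isStableBranch_neg {β : ℝ} {M : ℝ → ℝ} {J : Set ℝ} {κ δ D : ℝ}
    (hM : IsStableBranch β M J κ δ D) :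
    IsStableBranch β (fun h => -M (-h)) {h | -h ∈ J} κ δ D where
  deriv_bound h hh := by
    obtain ⟨d, hd, hd'⟩ := hM.deriv_bound (-h) hh
    refine ⟨d, hd, ?_⟩
    have h1 := (hd'.comp h (hasDerivAt_neg h)).neg
    exact h1.congr_deriv (by simp)
  equilibrium h hh := by
    have := hM.equilibrium (-h) hh
    rw [show β * (h + -M (-h)) = -(β * (-h + M (-h))) by ring, Real.tanh_neg, this]
  drift_le h hh x h1 h2 := by
    have := hM.le_drift (-h) hh (-x) (by linarith) (by linarith)
    rw [show β * (-h + -x) = -(β * (h + x)) by ring, Real.tanh_neg] at this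
    linarith
  le_drift h hh x h1 h2 := by
    have := hM.drift_le (-h) hh (-x) (by linarith) (by linarith)
    rw [show β * (-h + -x) = -(β * (h + x)) by ring, Real.tanh_neg] at this
    linarith

/-- At the equilibrium the drift has slope `β (1 - m ^ 2) - 1 ≤ -2κ`. Within distance `δ` the value
of `tanh` moves by at most `β δ`, so the slope changes by at most `2 β ^ 2 δ ≤ κ`. -/
lemma drift_sub_drift_le {β h m κ δ x y : ℝ} (hβ : 0 < β) (hm : m ∈ Ioo (-1 : ℝ) 1)
    (heq : Real.tanh (β * (h + m)) = m) (hκ : 2 * κ ≤ 1 - β * (1 - m ^ 2))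
    (hδ : 2 * β ^ 2 * δ ≤ κ) (hx : m - δ ≤ x) (hxy : x ≤ y) (hy : y ≤ m + δ) :
    (Real.tanh (β * (h + y)) - y) - (Real.tanh (β * (h + x)) - x) ≤ -κ * (y - x) := by
  have hd : ∀ z, HasDerivAt (fun z => Real.tanh (β * (h + z)) - z)
      ((1 - Real.tanh (β * (h + z)) ^ 2) * β - 1) z := fun z => by
    have h1 : HasDerivAt (fun z => β * (h + z)) β z := by
      simpa using ((hasDerivAt_id z).const_add h).const_mul β
    exact ((hasDerivAt_tanh _).comp z h1).sub (hasDerivAt_id z)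
  refine (convex_Icc x y).image_sub_le_mul_sub_of_deriv_le
    (f := fun z => Real.tanh (β * (h + z)) - z) (fun z _ => (hd z).continuousAt.continuousWithinAt)
    (fun z _ => (hd z).differentiableAt.differentiableWithinAt) (fun z hz => ?_)
    x ⟨le_rfl, hxy⟩ y ⟨hxy, le_rfl⟩ hxy
  rw [interior_Icc] at hz
  rw [(hd z).deriv]
  set T := Real.tanh (β * (h + z)) with hT
  have hzm : |z - m| ≤ δ := abs_le.2 ⟨by linarith [hz.1], by linarith [hz.2]⟩
  have h1 : |T - m| ≤ β * δ := by
    have := abs_tanh_sub_tanh_le (β * (h + z)) (β * (h + m))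
    rw [heq] at this
    refine this.trans ?_
    rw [show β * (h + z) - β * (h + m) = β * (z - m) by ring, abs_mul, abs_of_pos hβ]
    gcongr
  have hT1 := Real.tanh_lt_one (β * (h + z))
  have hT2 := Real.neg_one_lt_tanh (β * (h + z))
  have h2 : |T + m| ≤ 2 := abs_le.2 ⟨by linarith [hm.1], by linarith [hm.2]⟩
  have h3 : m ^ 2 - T ^ 2 ≤ 2 * (β * δ) := by
    calc m ^ 2 - T ^ 2 ≤ |T + m| * |T - m| := by
          rw [← abs_mul]; refine le_trans ?_ (neg_abs_le _ |> neg_le.1); linarith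
      _ ≤ 2 * (β * δ) := by gcongr
  nlinarith

lemma exists_isStableBranch_mMinus {β : ℝ} (hβ : 1 < β) {q : ℝ} (hq : q < criticalField β) :
    ∃ κ > 0, ∃ δ > 0, ∃ D, IsStableBranch β (mMinus β) (Iic q) κ δ D := by
  have hβ0 : 0 < β := by linarith
  have h0 := spinodal_pos hβ
  obtain ⟨hmq, -⟩ := mMinus_spec hβ hq
  set r := β * (1 - mMinus β q ^ 2) with hr
  have hr1 : 0 < 1 - r := one_sub_pos_of_mem hβ hmq
  have hle : ∀ h ≤ q, β * (1 - mMinus β h ^ 2) ≤ r := by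
    intro h hh
    have h1 := mMinus_mono hβ hq hh
    rw [hr]
    exact mul_le_mul_of_nonneg_left (sub_le_sub_left (by nlinarith [hmq.2]) _) hβ0.le
  have hmI : ∀ h ≤ q, mMinus β h ∈ Ioo (-1 : ℝ) 1 := fun h hh => by
    obtain ⟨h1, -⟩ := mMinus_spec hβ (lt_of_le_of_lt hh hq)
    exact ⟨h1.1, by linarith [h1.2]⟩
  have heq : ∀ h ≤ q, Real.tanh (β * (h + mMinus β h)) = mMinus β h := fun h hh => by
    obtain ⟨-, h2⟩ := mMinus_spec hβ (lt_of_le_of_lt hh hq)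
    have : β * (h + mMinus β h) = Real.artanh (mMinus β h) := by
      rw [stateField] at h2
      have h3 : h + mMinus β h = Real.artanh (mMinus β h) / β := by linarith
      rw [h3]
      field_simp
    rw [this, Real.tanh_artanh (hmI h hh)]
  have hδ : 2 * β ^ 2 * ((1 - r) / 2 / (2 * β ^ 2)) ≤ (1 - r) / 2 := by
    rw [mul_div_cancel₀ _ (by positivity)]
  -- Since `mMinus` is negative and monotone in the field, `β (1 - mMinus ^ 2)` is largest at `q`,
  -- where it equals `r < 1`. This gives uniform constants on the unbounded set `Iic q`.
  refine ⟨(1 - r) / 2, by linarith, (1 - r) / 2 / (2 * β ^ 2), by positivity, r / (1 - r), ?_, heq,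
    ?_, ?_⟩
  · intro h hh
    refine ⟨_, ?_, hasDerivAt_mMinus hβ (lt_of_le_of_lt hh hq)⟩
    have h1 := hle h hh
    have h2 := hmI h hh
    have h3 : 0 < β * (1 - mMinus β h ^ 2) := mul_pos hβ0 (by nlinarith [h2.1, h2.2])
    rw [abs_of_pos (div_pos h3 (by linarith))]
    exact div_le_div₀ (h3.le.trans h1) h1 hr1 (by linarith)
  · intro h hh x h1 h2
    have hδ0 : 0 < (1 - r) / 2 / (2 * β ^ 2) := by positivity
    have := drift_sub_drift_le hβ0 (hmI h hh) (heq h hh) (κ := (1 - r) / 2)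
      (by linarith [hle h hh]) hδ (by linarith) h1 h2
    rw [heq h hh] at this
    linarith
  · intro h hh x h1 h2
    have hδ0 : 0 < (1 - r) / 2 / (2 * β ^ 2) := by positivity
    have := drift_sub_drift_le hβ0 (hmI h hh) (heq h hh) (κ := (1 - r) / 2)
      (by linarith [hle h hh]) hδ h1 h2 (by linarith)
    rw [heq h hh] at this
    linarith

lemma exists_isStableBranch_mPlus {β : ℝ} (hβ : 1 < β) {q : ℝ} (hq : q < criticalField β) :
    ∃ κ > 0, ∃ δ > 0, ∃ D, IsStableBranch β (mPlus β) (Ici (-q)) κ δ D := by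
  obtain ⟨κ, hκ, δ, hδ, D, hM⟩ := exists_isStableBranch_mMinus hβ hq
  refine ⟨κ, hκ, δ, hδ, D, ?_⟩
  have h1 : (fun h => -mMinus β (-h)) = mPlus β := funext fun h => (mPlus_eq β h).symm
  have h2 : {h : ℝ | -h ∈ Iic q} = Ici (-q) := by ext h; exact neg_le (a := h) (b := q)
  have := isStableBranch_neg hM
  rwa [h1, h2] at this

/-! ### Exponential Lyapunov functions -/

/-- The only discrepancy from the mean field drift is the shift `±1/N` inside the rates, and `tanh`
is 1-Lipschitz. -/
lemma abs_drift_sub_le {β h m : ℝ} {N : ℕ} (hβ : 0 < β) (hN : 0 < N) (hm : m ∈ Icc (-1 : ℝ) 1) :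
    |2 / N * (ratePlus β N h m - rateMinus β N h m) - (Real.tanh (β * (h + m)) - m)| ≤ β / N := by
  have hN' : (0 : ℝ) < N := by exact_mod_cast hN
  set T := Real.tanh (β * (h + m)) with hT
  have hp : |Real.tanh (β * (h + (m + 1 / N))) - T| ≤ β / N := by
    refine (abs_tanh_sub_tanh_le _ _).trans_eq ?_
    rw [show β * (h + (m + 1 / N)) - β * (h + m) = β / N by ring, abs_of_pos (by positivity)]
  have hq : |Real.tanh (β * (h + (m - 1 / N))) - T| ≤ β / N := by
    refine (abs_tanh_sub_tanh_le _ _).trans_eq ?_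
    rw [show β * (h + (m - 1 / N)) - β * (h + m) = -(β / N) by ring, abs_neg,
      abs_of_pos (by positivity)]
  rw [ratePlus_eq, rateMinus_eq]
  set T₁ := Real.tanh (β * (h + (m + 1 / N)))
  set T₂ := Real.tanh (β * (h + (m - 1 / N)))
  have h1 : 2 / (N : ℝ) * ((N : ℝ) / 2 * (1 - m) * ((1 + T₁) / 2)
      - (N : ℝ) / 2 * (1 + m) * ((1 - T₂) / 2)) - (T - m)
      = (1 - m) / 2 * (T₁ - T) + (1 + m) / 2 * (T₂ - T) := by
    field_simp; ring
  rw [h1]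
  have hm1 : 0 ≤ (1 - m) / 2 := by linarith [hm.2]
  have hm2 : 0 ≤ (1 + m) / 2 := by linarith [hm.1]
  calc _ ≤ |(1 - m) / 2 * (T₁ - T)| + |(1 + m) / 2 * (T₂ - T)| := abs_add_le _ _
    _ = (1 - m) / 2 * |T₁ - T| + (1 + m) / 2 * |T₂ - T| := by
        rw [abs_mul, abs_mul, abs_of_nonneg hm1, abs_of_nonneg hm2]
    _ ≤ (1 - m) / 2 * (β / N) + (1 + m) / 2 * (β / N) := by gcongr
    _ = β / N := by ring

/-- A jump changes the exponent by `±u` with `u ^ 2 = 4 / N`. The second-order terms sum to at most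
4 because the total rate is at most `N`; the drift error costs at most `β`, using only `|σ| ≤ N`.
The condition `4 ≤ N` ensures `|u| ≤ 1`. -/
lemma generator_exp_le {β h m M σ : ℝ} {N : ℕ} (hβ : 0 < β) (hN : 4 ≤ N)
    (hm : m ∈ Icc (-1 : ℝ) 1) (hσ : σ ^ 2 = N) :
    generator β N h (fun x => Real.exp (σ * (x - M))) m
      ≤ Real.exp (σ * (m - M)) * (σ * (Real.tanh (β * (h + m)) - m) + β + 4) := by
  have hN4 : (4 : ℝ) ≤ N := by exact_mod_cast hN
  have hN' : (0 : ℝ) < N := by linarith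
  have hσN : |σ| ≤ N := abs_le_of_sq_le_sq (by nlinarith) hN'.le
  set u := 2 * σ / N with hu
  have hu2 : u ^ 2 = 4 / N := by
    rw [hu, div_pow, mul_pow, hσ]; field_simp; norm_num
  have hu1 : |u| ≤ 1 := by
    rw [← sq_le_one_iff_abs_le_one, hu2, div_le_one hN']; exact hN4
  have e1 : Real.exp u - 1 ≤ u + 4 / N := by
    have := (abs_le.1 (Real.abs_exp_sub_one_sub_id_le hu1)).2
    rw [hu2] at this; linarith
  have e2 : Real.exp (-u) - 1 ≤ -u + 4 / N := by
    have := (abs_le.1 (Real.abs_exp_sub_one_sub_id_le (x := -u) (by rwa [abs_neg]))).2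
    rw [neg_sq, hu2] at this; linarith
  have f1 : Real.exp (σ * (m + 2 / N - M)) = Real.exp (σ * (m - M)) * Real.exp u := by
    rw [← Real.exp_add]; congr 1; rw [hu]; ring
  have f2 : Real.exp (σ * (m - 2 / N - M)) = Real.exp (σ * (m - M)) * Real.exp (-u) := by
    rw [← Real.exp_add]; congr 1; rw [hu]; ring
  have hp := ratePlus_nonneg (β := β) (h := h) (N := N) hm
  have hq := rateMinus_nonneg (β := β) (h := h) (N := N) hm
  have hs := ratePlus_add_rateMinus_le (β := β) (h := h) (N := N) hm
  have hd := abs_drift_sub_le (h := h) hβ (by omega : 0 < N) hm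
  unfold generator
  simp only [f1, f2]
  set E := Real.exp (σ * (m - M))
  set p := ratePlus β N h m
  set q := rateMinus β N h m
  have hE : 0 < E := Real.exp_pos _
  have h1 : p * (Real.exp u - 1) + q * (Real.exp (-u) - 1)
      ≤ σ * (2 / N * (p - q)) + 4 := by
    calc _ ≤ p * (u + 4 / N) + q * (-u + 4 / N) := by gcongr
      _ = σ * (2 / N * (p - q)) + (p + q) * (4 / N) := by rw [hu]; ring
      _ ≤ σ * (2 / N * (p - q)) + N * (4 / N) := by gcongr
      _ = _ := by rw [mul_div_cancel₀ _ hN'.ne']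
  have h2 : σ * (2 / N * (p - q)) ≤ σ * (Real.tanh (β * (h + m)) - m) + β := by
    have : σ * (2 / N * (p - q) - (Real.tanh (β * (h + m)) - m)) ≤ N * (β / N) :=
      (le_abs_self _).trans (by rw [abs_mul]; gcongr)
    rw [mul_div_cancel₀ _ hN'.ne'] at this
    linarith
  calc p * (E * Real.exp u - E) + q * (E * Real.exp (-u) - E)
      = E * (p * (Real.exp u - 1) + q * (Real.exp (-u) - 1)) := by ring
    _ ≤ _ := mul_le_mul_of_nonneg_left (by linarith) hE.le

/-- For `u ≥ C / κ` the attraction wins and the left side is nonpositive; for `0 ≤ u ≤ C / κ` the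
exponential is bounded; for `u ≤ 0` the estimate `exp u * |u| ≤ 1` controls the linear growth of
`v`. -/
lemma exp_mul_le {κ C L u v : ℝ} (hκ : 0 < κ) (hC : 0 ≤ C) (hL : 0 ≤ L)
    (h1 : 0 ≤ u → v ≤ -(κ * u)) (h2 : v ≤ L * |u|) :
    Real.exp u * (v + C) ≤ C * Real.exp (C / κ) + C + L := by
  have hE : 0 < Real.exp u := Real.exp_pos u
  have hc : 0 ≤ C * Real.exp (C / κ) := mul_nonneg hC (Real.exp_pos _).le
  rcases le_total 0 u with hu | hu
  · have hv := h1 hu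
    rcases le_total (C / κ) u with hcu | hcu
    · have : C ≤ κ * u := by rwa [div_le_iff₀' hκ] at hcu
      have : Real.exp u * (v + C) ≤ 0 := mul_nonpos_of_nonneg_of_nonpos hE.le (by linarith)
      linarith
    · have : Real.exp u * (v + C) ≤ Real.exp (C / κ) * C := by
        have h3 : v + C ≤ C := by nlinarith
        calc _ ≤ Real.exp u * C := by gcongr
          _ ≤ _ := by gcongr
      linarith
  · rw [abs_of_nonpos hu] at h2
    have h3 : Real.exp u * (-u) ≤ 1 := by
      have h4 := Real.add_one_le_exp (-u)
      have h5 : Real.exp u * Real.exp (-u) = 1 := by rw [← Real.exp_add]; simp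
      nlinarith
    have h6 : Real.exp u ≤ 1 := Real.exp_le_one_iff.2 hu
    calc Real.exp u * (v + C) ≤ Real.exp u * (L * -u + C) := by gcongr
      _ = L * (Real.exp u * (-u)) + Real.exp u * C := by ring
      _ ≤ L * 1 + 1 * C := by gcongr
      _ ≤ _ := by linarith

/-- A bound for `(∂ₜ + L) exp (± √N (x - M))` near a stable branch. -/
def lyapunovConst (β κ C : ℝ) : ℝ :=
  (β + 4 + C) * Real.exp ((β + 4 + C) / κ) + (β + 4 + C) + (1 + β)

lemma lyapunovConst_nonneg {β κ C : ℝ} (hβ : 0 < β) (hC : 0 ≤ C) : 0 ≤ lyapunovConst β κ C := by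
  unfold lyapunovConst; positivity

lemma IsStableBranch.generator_exp_add_le {β κ δ D : ℝ} {M : ℝ → ℝ} {J : Set ℝ}
    (hM : IsStableBranch β M J κ δ D) (hβ : 0 < β) (hκ : 0 < κ) {N : ℕ} (hN : 4 ≤ N)
    {h m σ C ν : ℝ} (hh : h ∈ J) (hm : m ∈ Icc (-1 : ℝ) 1) (hσ : σ ^ 2 = N)
    (hmδ : |m - M h| ≤ δ) (hC : 0 ≤ C) (hν : ν ≤ C) :
    Real.exp (σ * (m - M h)) * ν + generator β N h (fun x => Real.exp (σ * (x - M h))) m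
      ≤ lyapunovConst β κ C := by
  have h1 := generator_exp_le (h := h) (M := M h) hβ hN hm hσ
  obtain ⟨hlo, hhi⟩ := abs_le.1 hmδ
  have h2 : Real.exp (σ * (m - M h)) * (σ * (Real.tanh (β * (h + m)) - m) + (β + 4 + C))
      ≤ lyapunovConst β κ C := by
    -- Here `u = σ (m - M h)` and `v = σ` times the drift. When `u ≥ 0` the drift opposes `u` for
    -- either sign of `σ`; the bound `L = 1 + β` is the Lipschitz constant of the drift.
    refine exp_mul_le hκ (by linarith) (by linarith) (fun hu => ?_) ?_
    · rcases lt_trichotomy 0 σ with hs | hs | hs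
      · have hy : 0 ≤ m - M h := nonneg_of_mul_nonneg_right hu hs
        have := hM.drift_le h hh m (by linarith) (by linarith)
        nlinarith
      · simp [← hs]
      · have hy : m - M h ≤ 0 := by nlinarith
        have := hM.le_drift h hh m (by linarith) (by linarith)
        nlinarith
    · have h3 := abs_tanh_sub_tanh_le (β * (h + m)) (β * (h + M h))
      rw [hM.equilibrium h hh, show β * (h + m) - β * (h + M h) = β * (m - M h) by ring, abs_mul,
        abs_of_pos hβ] at h3
      have h4 : |Real.tanh (β * (h + m)) - m| ≤ (1 + β) * |m - M h| := by
        calc _ = |(Real.tanh (β * (h + m)) - M h) - (m - M h)| := by ring_nf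
          _ ≤ |Real.tanh (β * (h + m)) - M h| + |m - M h| := abs_sub _ _
          _ ≤ _ := by linarith
      calc σ * (Real.tanh (β * (h + m)) - m) ≤ |σ| * |Real.tanh (β * (h + m)) - m| := by
            rw [← abs_mul]; exact le_abs_self _
        _ ≤ |σ| * ((1 + β) * |m - M h|) := by gcongr
        _ = (1 + β) * |σ * (m - M h)| := by rw [abs_mul]; ring
  have h5 : Real.exp (σ * (m - M h)) * ν ≤ Real.exp (σ * (m - M h)) * C := by gcongr
  calc _ ≤ Real.exp (σ * (m - M h)) * C + Real.exp (σ * (m - M h)) *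
        (σ * (Real.tanh (β * (h + m)) - m) + β + 4) := add_le_add h5 h1
    _ = Real.exp (σ * (m - M h)) * (σ * (Real.tanh (β * (h + m)) - m) + (β + 4 + C)) := by ring
    _ ≤ _ := h2

/-! ### A smooth concave truncation -/

/-- A `C¹`, concave, nondecreasing function which is constant on `[K, ∞)`. -/
def truncation (K z : ℝ) : ℝ := K ^ 2 - max (K - z) 0 ^ 2

lemma truncation_le_tangent (K z w : ℝ) :
    truncation K w - truncation K z ≤ 2 * max (K - z) 0 * (w - z) := by
  unfold truncation
  rcases le_total (K - z) 0 with h | h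
  · rw [max_eq_right h]; nlinarith [sq_nonneg (max (K - w) 0)]
  · rw [max_eq_left h]
    nlinarith [le_max_left (K - w) 0, le_max_right (K - w) 0,
      sq_nonneg (K - z - max (K - w) 0)]

lemma tangent_sub_le_truncation (K z w : ℝ) :
    2 * max (K - z) 0 * (w - z) - (w - z) ^ 2 ≤ truncation K w - truncation K z := by
  unfold truncation
  rcases le_total (K - z) 0 with h | h <;> rcases le_total (K - w) 0 with h' | h'
  · rw [max_eq_right h, max_eq_right h']; nlinarith
  · rw [max_eq_right h, max_eq_left h']; nlinarith
  · rw [max_eq_left h, max_eq_right h']; nlinarith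
  · rw [max_eq_left h, max_eq_left h']; nlinarith

lemma hasDerivAt_truncation (K z : ℝ) :
    HasDerivAt (truncation K) (2 * max (K - z) 0) z := by
  rw [hasDerivAt_iff_isLittleO]
  have hO : (fun w => truncation K w - truncation K z - (w - z) • (2 * max (K - z) 0))
      =O[𝓝 z] fun w => (w - z) ^ 2 := by
    refine Asymptotics.IsBigO.of_bound 1 (Eventually.of_forall fun w => ?_)
    have h1 := truncation_le_tangent K z w
    have h2 := tangent_sub_le_truncation K z w
    rw [Real.norm_eq_abs, Real.norm_eq_abs, abs_of_nonneg (sq_nonneg (w - z)), one_mul,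
      smul_eq_mul, abs_le]
    constructor <;> nlinarith [sq_nonneg (w - z)]
  refine hO.trans_isLittleO ?_
  have h3 : Tendsto (fun w : ℝ => w - z) (𝓝 z) (𝓝 0) := by
    simpa using (continuous_sub_right z).tendsto z
  exact (Asymptotics.isLittleO_pow_id one_lt_two).comp_tendsto h3

lemma truncation_nonneg {K z : ℝ} (hK : 0 ≤ K) (hz : 0 ≤ z) : 0 ≤ truncation K z := by
  have : max (K - z) 0 ^ 2 ≤ K ^ 2 :=
    pow_le_pow_left₀ (le_max_right _ _) (max_le (by linarith) hK) 2
  unfold truncation; linarith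

lemma truncation_of_le {K z : ℝ} (h : K ≤ z) : truncation K z = K ^ 2 := by
  rw [truncation, max_eq_right (by linarith)]; ring

lemma truncation_le {K z : ℝ} (hK : 0 ≤ K) : truncation K z ≤ 2 * K * z := by
  have := truncation_le_tangent K 0 z
  simpa [truncation, max_eq_left hK] using this

/-- Concavity: each increment lies below its tangent, and the jump rates are nonnegative. -/
lemma generator_truncation_le {β h m K : ℝ} {N : ℕ} (hm : m ∈ Icc (-1 : ℝ) 1) (G : ℝ → ℝ) :
    generator β N h (fun x => truncation K (G x)) m
      ≤ 2 * max (K - G m) 0 * generator β N h G m := by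
  have hp := ratePlus_nonneg (β := β) (h := h) (N := N) hm
  have hq := rateMinus_nonneg (β := β) (h := h) (N := N) hm
  unfold generator
  calc _ ≤ ratePlus β N h m * (2 * max (K - G m) 0 * (G (m + 2 / N) - G m))
        + rateMinus β N h m * (2 * max (K - G m) 0 * (G (m - 2 / N) - G m)) := by
        gcongr <;> exact truncation_le_tangent _ _ _
    _ = _ := by ring

/-! ### Deviation estimate at fixed `N` -/

lemma IsMagnetizationProcess.measure_deviation_le {Ω : Type*} [mΩ : MeasurableSpace Ω]
    {P : Measure Ω} [IsProbabilityMeasure P] {β : ℝ} {N : ℕ} {h : ℝ → ℝ} {a b m₀ : ℝ}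
    {X : ℝ → Ω → ℝ} (hX : IsMagnetizationProcess P β N h a b m₀ X) (hh : Continuous h)
    (hβ : 0 < β) (hN : 4 ≤ N) {M : ℝ → ℝ} {J : Set ℝ} {κ δ D E R c : ℝ}
    (hM : IsStableBranch β M J κ δ D) (hκ : 0 < κ) (hac : a ≤ c) (hcb : c ≤ b)
    (hJ : ∀ t ∈ Icc a c, h t ∈ J)
    (hE : ∀ t ∈ Icc a c, ∃ e, √(N : ℝ) * |e| ≤ E ∧ HasDerivAt h e t)
    (hR : R ≤ √(N : ℝ) * δ) :
    P {ω | ∃ t ∈ Icc a c, R < √(N : ℝ) * |X t ω - M (h t)|} ≤ ENNReal.ofReal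
      (4 * (Real.exp (√(N : ℝ) * |m₀ - M (h a)|) + lyapunovConst β κ (D * E) * (c - a))
        / Real.exp R) := by
  set θ := √(N : ℝ) with hθ
  have hN4 : (4 : ℝ) ≤ N := by exact_mod_cast hN
  have hθ0 : 0 < θ := Real.sqrt_pos.2 (by linarith)
  have hθ2 : θ ^ 2 = N := Real.sq_sqrt (by linarith)
  have haI : a ∈ Icc a c := ⟨le_rfl, hac⟩
  have hD0 : 0 ≤ D := by
    obtain ⟨d, hd, -⟩ := hM.deriv_bound _ (hJ a haI)
    exact (abs_nonneg d).trans hd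
  have hE0 : 0 ≤ E := by
    obtain ⟨e, he, -⟩ := hE a haI
    exact le_trans (by positivity) he
  set L := lyapunovConst β κ (D * E) with hL
  have hL0 : 0 ≤ L := lyapunovConst_nonneg hβ (mul_nonneg hD0 hE0)
  set K := Real.exp R with hK
  have hK0 : 0 < K := Real.exp_pos R
  let μ : ℝ → ℝ := fun t => deriv (fun t => M (h t)) t
  have hμ : ∀ t ∈ Icc a c, HasDerivAt (fun t => M (h t)) (μ t) t ∧ |θ * μ t| ≤ D * E := by
    intro t ht
    obtain ⟨d, hd, hd'⟩ := hM.deriv_bound _ (hJ t ht)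
    obtain ⟨e, he, he'⟩ := hE t ht
    have hc : HasDerivAt (fun t => M (h t)) (d * e) t := hd'.comp t he'
    have hμe : μ t = d * e := hc.deriv
    rw [hμe]
    refine ⟨hc, ?_⟩
    calc |θ * (d * e)| = |d| * (θ * |e|) := by rw [abs_mul, abs_mul, abs_of_pos hθ0]; ring
      _ ≤ D * E := by gcongr
  let G : ℝ → ℝ → ℝ := fun t x => Real.exp (θ * (x - M (h t))) + Real.exp (-θ * (x - M (h t)))
  let G' : ℝ → ℝ → ℝ := fun t x => Real.exp (θ * (x - M (h t))) * (-(θ * μ t))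
    + Real.exp (-θ * (x - M (h t))) * (θ * μ t)
  have hG0 : ∀ t x, 0 ≤ G t x := fun t x => by positivity
  have hGd : ∀ x, ∀ t ∈ Icc a c, HasDerivAt (fun t => G t x) (G' t x) t := by
    intro x t ht
    have h1 : ∀ σ : ℝ, HasDerivAt (fun t => Real.exp (σ * (x - M (h t))))
        (Real.exp (σ * (x - M (h t))) * (σ * (-μ t))) t := fun σ =>
      (((hμ t ht).1.const_sub x).const_mul σ).exp
    refine ((h1 θ).add (h1 (-θ))).congr_deriv ?_
    simp only [G']; ring
  have hGge : ∀ t x, Real.exp (θ * |x - M (h t)|) ≤ G t x := by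
    intro t x
    rcases abs_cases (x - M (h t)) with ⟨h1, -⟩ | ⟨h1, -⟩
    · rw [h1]; exact le_add_of_nonneg_right (Real.exp_pos _).le
    · rw [h1, mul_neg, ← neg_mul]; exact le_add_of_nonneg_left (Real.exp_pos _).le
  have hGle : ∀ t x, G t x ≤ 2 * Real.exp (θ * |x - M (h t)|) := by
    intro t x
    have h1 : Real.exp (θ * (x - M (h t))) ≤ Real.exp (θ * |x - M (h t)|) := by
      gcongr; exact le_abs_self _
    have h2 : Real.exp (-θ * (x - M (h t))) ≤ Real.exp (θ * |x - M (h t)|) := by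
      rw [neg_mul, ← mul_neg]; gcongr; exact neg_le_abs _
    simp only [G]; linarith
  have hgenG : ∀ x ∈ states N, ∀ t ∈ Icc a c, G t x < K →
      G' t x + generator β N (h t) (G t) x ≤ 2 * L := by
    intro x hx t ht hlt
    have hxδ : |x - M (h t)| ≤ δ := by
      have h1 : θ * |x - M (h t)| < R := Real.exp_lt_exp.1 ((hGge t x).trans_lt hlt)
      exact le_of_mul_le_mul_left (h1.le.trans hR) hθ0
    have hb := abs_le.1 (hμ t ht).2
    have hxI := mem_Icc_of_mem_states hx
    have h1 := hM.generator_exp_add_le hβ hκ hN (hJ t ht) hxI hθ2 hxδ (mul_nonneg hD0 hE0)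
      (ν := -(θ * μ t)) (by linarith)
    have h2 := hM.generator_exp_add_le hβ hκ hN (hJ t ht) hxI (σ := -θ) (by rw [neg_sq, hθ2]) hxδ
      (mul_nonneg hD0 hE0) (ν := θ * μ t) hb.2
    have h3 : generator β N (h t) (G t) x
        = generator β N (h t) (fun x => Real.exp (θ * (x - M (h t)))) x
          + generator β N (h t) (fun x => Real.exp (-θ * (x - M (h t)))) x := by
      simp only [generator, G]; ring
    rw [h3]
    simp only [G']
    linarith
  -- The truncated function equals `K ^ 2` on the bad set and has slope at most `2 K`. A bound `2 L`
  -- for `G` thus becomes `4 K L`, and dividing by `K ^ 2` leaves the factor `1 / K = exp (-R)`.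
  have hmax := hX.measure_exists_le hh hac hcb (C := 4 * K * L) (l := K ^ 2) (by positivity)
    (by positivity) (F := fun t x => truncation K (G t x))
    (F' := fun t x => 2 * max (K - G t x) 0 * G' t x) ?_
    (fun t x => truncation_nonneg hK0.le (hG0 t x)) ?_ ?_ ?_ (bad := fun t x => K < G t x)
    (fun t x hb => (truncation_of_le hb.le).ge) ?_
  · refine (measure_mono ?_).trans (hmax.trans (ENNReal.ofReal_le_ofReal ?_))
    · rintro ω ⟨t, ht, hω⟩
      exact ⟨t, ht, (Real.exp_lt_exp.2 hω).trans_le (hGge t _)⟩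
    · rw [div_le_div_iff₀ (by positivity) hK0]
      have h1 : truncation K (G a m₀) ≤ 4 * K * Real.exp (θ * |m₀ - M (h a)|) := by
        calc _ ≤ 2 * K * G a m₀ := truncation_le hK0.le
          _ ≤ 2 * K * (2 * Real.exp (θ * |m₀ - M (h a)|)) := by gcongr; exact hGle _ _
          _ = _ := by ring
      calc _ ≤ (4 * K * Real.exp (θ * |m₀ - M (h a)|) + 4 * K * L * (c - a)) * K := by gcongr
        _ = _ := by ring
  · intro t
    have : Continuous fun x => truncation K (G t x) := by
      simp only [truncation, G]; fun_prop
    exact this.measurable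
  · intro x _ t ht
    exact ((hasDerivAt_truncation K _).comp t (hGd x t ht)).continuousAt.continuousWithinAt
  · intro x _ t ht
    exact ((hasDerivAt_truncation K _).comp t (hGd x t ⟨ht.1, ht.2.le⟩)).hasDerivWithinAt
  · intro x hx t ht
    have h1 := generator_truncation_le (β := β) (h := h t) (K := K) (N := N)
      (mem_Icc_of_mem_states hx) (G t)
    rcases le_or_gt K (G t x) with hle | hlt
    -- Where `G` exceeds `K` the slope of the truncation is zero, so nothing about the dynamics away
    -- from the branch is needed.
    · rw [max_eq_right (by linarith)] at h1 ⊢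
      have : (0 : ℝ) ≤ 4 * K * L := by positivity
      linarith
    · have h2 := hgenG x hx t ⟨ht.1, ht.2.le⟩ hlt
      have h3 := hG0 t x
      have h4 : 0 ≤ K - G t x := by linarith
      rw [max_eq_left h4] at h1 ⊢
      calc _ ≤ 2 * (K - G t x) * (G' t x + generator β N (h t) (G t) x) := by linarith
        _ ≤ 2 * (K - G t x) * (2 * L) := by gcongr
        _ ≤ 2 * K * (2 * L) := by gcongr; linarith
        _ = 4 * K * L := by ring
  · intro x t ht hb
    have hc : ContinuousAt (fun t => G t x) t := (hGd x t ⟨ht.1, ht.2.le⟩).continuousAt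
    exact (hc.eventually_const_lt hb).filter_mono nhdsWithin_le_nhds

/-! ### Asymptotics -/

lemma sqrt_mul_tol {N : ℕ} (hN : 0 < N) (γ : ℝ) : √(N : ℝ) * tol N γ = (N : ℝ) ^ γ := by
  have hN' : (0 : ℝ) < N := by exact_mod_cast hN
  rw [tol, Real.sqrt_eq_rpow, ← Real.rpow_add hN']
  congr 1; ring

lemma tol_mono {N : ℕ} (hN : 0 < N) {γ γ' : ℝ} (h : γ ≤ γ') : tol N γ ≤ tol N γ' :=
  Real.rpow_le_rpow_of_exponent_le (by exact_mod_cast hN) (by linarith)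

lemma tendsto_natCast_rpow_atTop {γ : ℝ} (hγ : 0 < γ) :
    Tendsto (fun N : ℕ => (N : ℝ) ^ γ) atTop atTop :=
  (tendsto_rpow_atTop hγ).comp tendsto_natCast_atTop_atTop

lemma tendsto_tol_zero {γ : ℝ} (hγ : γ < 1 / 2) : Tendsto (fun N => tol N γ) atTop (𝓝 0) := by
  have h := (tendsto_rpow_neg_atTop (y := 1 / 2 - γ) (by linarith)).comp
    tendsto_natCast_atTop_atTop
  refine h.congr fun N => ?_
  simp only [Function.comp, tol]
  congr 1; ring

lemma tendsto_tol_atTop {γ : ℝ} (hγ : 1 / 2 < γ) : Tendsto (fun N => tol N γ) atTop atTop :=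
  tendsto_natCast_rpow_atTop (by linarith)

lemma tendsto_exp_rpow_div {γ γ' : ℝ} (hγ' : 0 < γ') (h : γ < γ') :
    Tendsto (fun N : ℕ => Real.exp ((N : ℝ) ^ γ) / Real.exp ((N : ℝ) ^ γ')) atTop (𝓝 0) := by
  have h1 : Tendsto (fun N : ℕ => (N : ℝ) ^ (-(γ' - γ)) - 1) atTop (𝓝 (0 - 1)) :=
    ((tendsto_rpow_neg_atTop (y := γ' - γ) (by linarith)).comp
      tendsto_natCast_atTop_atTop).sub_const 1
  have h2 := (tendsto_natCast_rpow_atTop hγ').atTop_mul_neg (by norm_num) h1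
  refine (Real.tendsto_exp_atBot.comp h2).congr' ?_
  filter_upwards [eventually_gt_atTop 0] with N hN
  have hN' : (0 : ℝ) < N := by exact_mod_cast hN
  rw [Function.comp, ← Real.exp_sub, mul_sub, ← Real.rpow_add hN', mul_one]
  congr 3; ring

lemma tendsto_rpow_div_exp_rpow (s : ℝ) {γ : ℝ} (hγ : 0 < γ) :
    Tendsto (fun N : ℕ => (N : ℝ) ^ s / Real.exp ((N : ℝ) ^ γ)) atTop (𝓝 0) := by
  have h := (tendsto_rpow_mul_exp_neg_mul_atTop_nhds_zero (s / γ) 1 one_pos).comp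
    (tendsto_natCast_rpow_atTop hγ)
  refine h.congr fun N => ?_
  rw [Function.comp, ← Real.rpow_mul N.cast_nonneg, mul_div_cancel₀ _ hγ.ne', neg_one_mul,
    Real.exp_neg, div_eq_mul_inv]

/-! ### The slow field -/

lemma continuous_field (β : ℝ) (N : ℕ) : Continuous (field β N) := by
  unfold field; fun_prop

lemma rpow_mul_mem_Icc {N : ℕ} (hN : 0 < N) {τ₀ τ₁ t : ℝ}
    (ht : t ∈ Icc (scaledTime N τ₀) (scaledTime N τ₁)) :
    (N : ℝ) ^ (-(2 / 3) : ℝ) * t ∈ Icc τ₀ τ₁ := by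
  have hN' : (0 : ℝ) < N := by exact_mod_cast hN
  have hp : (0 : ℝ) < (N : ℝ) ^ (2 / 3 : ℝ) := Real.rpow_pos_of_pos hN' _
  rw [Real.rpow_neg hN'.le]
  exact ⟨(le_inv_mul_iff₀ hp).2 ht.1, (inv_mul_le_iff₀ hp).2 ht.2⟩

/-- The field has speed `O(N^{-2/3})`, and `√N · N^{-2/3} ≤ 1`: the branch moves negligibly on the
fluctuation scale `N^{-1/2}` in unit time. -/
lemma exists_hasDerivAt_field (β : ℝ) {N : ℕ} (hN : 0 < N) (t : ℝ) :
    ∃ e, √(N : ℝ) * |e| ≤ |criticalField β| ∧ HasDerivAt (field β N) e t := by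
  have hN' : (0 : ℝ) < N := by exact_mod_cast hN
  have hN1 : (1 : ℝ) ≤ N := by exact_mod_cast hN
  set r := (N : ℝ) ^ (-(2 / 3) : ℝ) with hr
  have hr0 : 0 < r := Real.rpow_pos_of_pos hN' _
  have h1 : HasDerivAt (fun t => r * t) r t := by simpa using (hasDerivAt_id t).const_mul r
  refine ⟨_, ?_, (h1.cos.const_mul (-criticalField β))⟩
  have h2 : √(N : ℝ) * r ≤ 1 := by
    rw [hr, Real.sqrt_eq_rpow, ← Real.rpow_add hN']
    exact Real.rpow_le_one_of_one_le_of_nonpos hN1 (by norm_num)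
  have h3 := Real.abs_sin_le_one (r * t)
  rw [abs_mul, abs_mul, abs_neg, abs_neg, abs_of_pos hr0]
  calc √(N : ℝ) * (|criticalField β| * (|Real.sin (r * t)| * r))
      = |criticalField β| * (|Real.sin (r * t)| * (√(N : ℝ) * r)) := by ring
    _ ≤ |criticalField β| * (1 * 1) := by gcongr
    _ = _ := by ring

/-! ### Tracking -/

lemma TracksBranch.mono {β τ₀ τ₁ γ γ₁ γ₂ : ℝ} {M : ℝ → ℝ}
    (h : TracksBranch.{u} β M τ₀ τ₁ γ γ₁) (hγ : γ₁ ≤ γ₂) : TracksBranch.{u} β M τ₀ τ₁ γ γ₂ := by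
  intro Ω mΩ P hP m₀ X hX hm₀
  refine tendsto_of_tendsto_of_tendsto_of_le_of_le' (h Ω mΩ P hP m₀ X hX hm₀) tendsto_const_nhds
    ?_ (Eventually.of_forall fun N => prob_le_one)
  filter_upwards [eventually_gt_atTop 0] with N hN
  exact measure_mono fun ω hω t ht => (hω t ht).trans (tol_mono hN hγ)

/-- The tolerance `N^{γ' - 1/2}` eventually exceeds 2, the diameter of `[-1, 1]`, so the event is
everything. -/
lemma IsStableBranch.tracksBranch_of_half_lt {β κ δ D : ℝ} {M : ℝ → ℝ} {J : Set ℝ}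
    (hM : IsStableBranch β M J κ δ D) {τ₀ τ₁ γ γ' : ℝ} (hτ₁ : τ₁ ≤ Real.pi / 2)
    (hJ : ∀ τ ∈ Icc τ₀ τ₁, -criticalField β * Real.cos τ ∈ J) (hγ' : 1 / 2 < γ') :
    TracksBranch.{u} β M τ₀ τ₁ γ γ' := by
  intro Ω mΩ P hP m₀ X hX _
  refine tendsto_const_nhds.congr' ?_
  filter_upwards [eventually_gt_atTop 0,
    (tendsto_tol_atTop hγ').eventually_ge_atTop 2] with N hN htol
  have huniv : nearBranch β N M γ' (Icc (scaledTime N τ₀) (scaledTime N τ₁)) (X N) = univ := by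
    refine eq_univ_of_forall fun ω t ht => ?_
    have hb : scaledTime N τ₁ ≤ scaledTime N (Real.pi / 2) := by unfold scaledTime; gcongr
    have hx := mem_Icc_of_mem_states ((hX N).mem_states t ⟨ht.1, ht.2.trans hb⟩ ω)
    have heq := hM.equilibrium _ (hJ _ (rpow_mul_mem_Icc hN ht))
    have h1 := Real.tanh_lt_one (β * (field β N t + M (field β N t)))
    have h2 := Real.neg_one_lt_tanh (β * (field β N t + M (field β N t)))
    have heq' : Real.tanh (β * (field β N t + M (field β N t))) = M (field β N t) := heq
    rw [heq'] at h1 h2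
    exact (abs_le.2 ⟨by linarith [hx.1], by linarith [hx.2]⟩ : _ ≤ (2 : ℝ)).trans htol
  rw [huniv, measure_univ]

lemma IsStableBranch.tracksBranch_of_lt_half {β κ δ D : ℝ} {M : ℝ → ℝ} {J : Set ℝ}
    (hM : IsStableBranch β M J κ δ D) (hβ : 0 < β) (hκ : 0 < κ) (hδ : 0 < δ)
    {τ₀ τ₁ γ γ' : ℝ} (hτ : τ₀ ≤ τ₁) (hτ₁ : τ₁ ≤ Real.pi / 2)
    (hJ : ∀ τ ∈ Icc τ₀ τ₁, -criticalField β * Real.cos τ ∈ J)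
    (hγ'0 : 0 < γ') (hγγ' : γ < γ') (hγ' : γ' < 1 / 2) : TracksBranch.{u} β M τ₀ τ₁ γ γ' := by
  intro Ω mΩ P hP m₀ X hX hm₀
  set L := lyapunovConst β κ (D * |criticalField β|) with hL
  let bound : ℕ → ℝ := fun N => 4 * (Real.exp ((N : ℝ) ^ γ) / Real.exp ((N : ℝ) ^ γ')
    + L * (τ₁ - τ₀) * ((N : ℝ) ^ (2 / 3 : ℝ) / Real.exp ((N : ℝ) ^ γ')))
  have hbound : Tendsto bound atTop (𝓝 0) := by
    have := ((tendsto_exp_rpow_div hγ'0 hγγ').add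
      ((tendsto_rpow_div_exp_rpow (2 / 3) hγ'0).const_mul (L * (τ₁ - τ₀)))).const_mul 4
    simpa using this
  have hlow : Tendsto (fun N => 1 - ENNReal.ofReal (bound N)) atTop (𝓝 1) := by
    have h1 := ENNReal.tendsto_ofReal hbound
    simpa using ENNReal.Tendsto.sub (tendsto_const_nhds (x := (1 : ENNReal))) h1
      (Or.inl ENNReal.one_ne_top)
  refine tendsto_of_tendsto_of_tendsto_of_le_of_le' hlow tendsto_const_nhds ?_
    (Eventually.of_forall fun N => prob_le_one)
  filter_upwards [eventually_ge_atTop 4, hm₀,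
    (tendsto_tol_zero hγ').eventually_le_const hδ] with N hN hmN htol
  have hN0 : 0 < N := by omega
  have hN' : (0 : ℝ) < N := by exact_mod_cast hN0
  have hs : 0 < √(N : ℝ) := Real.sqrt_pos.2 hN'
  have hdev := (hX N).measure_deviation_le (continuous_field β N) hβ hN hM hκ
    (c := scaledTime N τ₁) (E := |criticalField β|) (R := (N : ℝ) ^ γ')
    (by unfold scaledTime; gcongr) (by unfold scaledTime; gcongr)
    (fun t ht => hJ _ (rpow_mul_mem_Icc hN0 ht)) (fun t _ => exists_hasDerivAt_field β hN0 t)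
    (by rw [← sqrt_mul_tol hN0]; gcongr)
  have hcompl : (nearBranch β N M γ' (Icc (scaledTime N τ₀) (scaledTime N τ₁)) (X N))ᶜ
      ⊆ {ω | ∃ t ∈ Icc (scaledTime N τ₀) (scaledTime N τ₁),
        (N : ℝ) ^ γ' < √(N : ℝ) * |X N t ω - M (field β N t)|} := by
    intro ω hω
    by_contra hcon
    refine hω fun t ht => ?_
    by_contra hlt
    refine hcon ⟨t, ht, ?_⟩
    rw [← sqrt_mul_tol hN0]
    exact mul_lt_mul_of_pos_left (not_le.1 hlt) hs
  have hle : P N (nearBranch β N M γ' (Icc (scaledTime N τ₀) (scaledTime N τ₁)) (X N))ᶜ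
      ≤ ENNReal.ofReal (bound N) := by
    refine (measure_mono hcompl).trans (hdev.trans (ENNReal.ofReal_le_ofReal ?_))
    have h1 : √(N : ℝ) * |m₀ N - M (field β N (scaledTime N τ₀))| ≤ (N : ℝ) ^ γ := by
      rw [← sqrt_mul_tol hN0]; gcongr
    calc _ ≤ 4 * (Real.exp ((N : ℝ) ^ γ) + L * (scaledTime N τ₁ - scaledTime N τ₀))
          / Real.exp ((N : ℝ) ^ γ') := by gcongr
      _ = bound N := by simp only [bound, scaledTime]; ring
  -- Subadditivity on the event and its complement replaces the complement rule, which would require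
  -- a measurable event.
  rw [tsub_le_iff_right]
  calc (1 : ENNReal) = P N univ := measure_univ.symm
    _ ≤ _ := by
      rw [← union_compl_self (nearBranch β N M γ' (Icc (scaledTime N τ₀) (scaledTime N τ₁)) (X N))]
      exact (measure_union_le _ _).trans (by gcongr)

lemma IsStableBranch.tracksBranch {β κ δ D : ℝ} {M : ℝ → ℝ} {J : Set ℝ}
    (hM : IsStableBranch β M J κ δ D) (hβ : 0 < β) (hκ : 0 < κ) (hδ : 0 < δ)
    {τ₀ τ₁ γ γ' : ℝ} (hτ : τ₀ ≤ τ₁) (hτ₁ : τ₁ ≤ Real.pi / 2)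
    (hJ : ∀ τ ∈ Icc τ₀ τ₁, -criticalField β * Real.cos τ ∈ J)
    (hγ : 0 < γ) (hγγ' : γ < γ') : TracksBranch.{u} β M τ₀ τ₁ γ γ' := by
  -- The Lyapunov bound needs a tolerance below `δ`, hence an exponent below `1/2`. If `γ < 1/2`,
  -- one first shrinks `γ'`; otherwise `γ' > 1/2` and the claim is trivial.
  rcases lt_or_ge γ (1 / 2) with h | h
  · obtain ⟨γ₁, h1, h2⟩ := exists_between (lt_min hγγ' h)
    exact (hM.tracksBranch_of_lt_half hβ hκ hδ hτ hτ₁ hJ (hγ.trans h1) h1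
      (h2.trans_le (min_le_right _ _))).mono (h2.trans_le (min_le_left _ _)).le
  · exact hM.tracksBranch_of_half_lt hτ₁ hJ (h.trans_lt hγγ')

end

end MeanFieldIsing

theorem theorem7p1 (β : ℝ) (hβ : 1 < β) :
    (∀ η γ γ' : ℝ, 0 < η → η < Real.pi / 2 → 0 < γ → γ < γ' →
      TracksBranch.{u} β (mPlus β) (-(Real.pi / 2)) (-η) γ γ' ∧
      TracksBranch.{u} β (mPlus β) η (Real.pi / 2) γ γ') ∧
    (∀ η γ γ' : ℝ, -(Real.pi / 2) ≤ η → η < Real.pi / 2 → 0 < γ → γ < γ' →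
      TracksBranch.{u} β (mMinus β) η (Real.pi / 2) γ γ') := by
  have hβ0 : 0 < β := by linarith
  have hc := criticalField_pos hβ
  have hpi := Real.pi_pos
  refine ⟨fun η γ γ' hη0 hη hγ hγγ' => ?_, fun η γ γ' hη0 hη hγ hγγ' => ?_⟩
  · have hcos : Real.cos η < 1 := by
      rw [← Real.cos_zero]
      exact Real.cos_lt_cos_of_nonneg_of_le_pi le_rfl (by linarith) hη0
    obtain ⟨κ, hκ, δ, hδ, D, hM⟩ := exists_isStableBranch_mPlus hβ
      (q := criticalField β * Real.cos η) (by nlinarith)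
    have hle : ∀ τ, η ≤ τ → τ ≤ Real.pi / 2 →
        -criticalField β * Real.cos τ ∈ Ici (-(criticalField β * Real.cos η)) := by
      intro τ h1 h2
      have := Real.cos_le_cos_of_nonneg_of_le_pi hη0.le (by linarith) h1
      rw [mem_Ici, neg_mul, neg_le_neg_iff]
      gcongr
    constructor
    -- The cosine is even, so this interval sees the same fields as `[η, π/2]`.
    · refine hM.tracksBranch hβ0 hκ hδ (by linarith) (by linarith) (fun τ hτ => ?_) hγ hγγ'
      rw [← Real.cos_neg τ]
      exact hle (-τ) (by linarith [hτ.2]) (by linarith [hτ.1])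
    · exact hM.tracksBranch hβ0 hκ hδ hη.le le_rfl (fun τ hτ => hle τ hτ.1 hτ.2) hγ hγγ'
  -- Here `q = 0`: on `[-π/2, π/2]` the field is never positive.
  · obtain ⟨κ, hκ, δ, hδ, D, hM⟩ := exists_isStableBranch_mMinus hβ hc
    refine hM.tracksBranch hβ0 hκ hδ hη.le le_rfl (fun τ hτ => ?_) hγ hγγ'
    have := Real.cos_nonneg_of_neg_pi_div_two_le_of_le (hη0.trans hτ.1) hτ.2
    rw [mem_Iic, neg_mul, neg_nonpos]
    positivity
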